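/- Let $k$ be a field of characteristic different from $2$, let $k_s$ be a separable closure of $k$ and $\Gamma_k=\mathrm{Gal}(k_s/k)$. Suppose that $\mathrm{cd}_2(k)\le 1$, i.e. $H^r(\Gamma_k,A)=0$ for all $r>1$ and all finite $2$-primary (discrete) $\Gamma_k$-modules $A$. A monic polynomial $f\in k[X]$ is called $\epsilon$-symmetric ($\epsilon=\pm1$) if $f(X)=\epsilon X^{\deg f}f(X^{-1})$, and symmetric if this holds with $\epsilon=1$; for monic $f$ with $f(0)\neq0$ put $f^*(X)=f(0)^{-1}X^{\deg f}f(X^{-1})$. A monic $\epsilon$-symmetric polynomial is of type $0$ if it is a product of powers of $X-1$ and $X+1$; of type $1$ if it is a product of powers of monic, symmetric, irreducible polynomials of even degree; of type $2$ if it is a product of polynomials $gg^*$ with $g$ monic, irreducible, $g(0)\ne0$ and $g\neq\pm g^*$. A $k[X]$-module, finite dimensional over $k$, is called self-dual if it is a finite direct sum of modules $k[X]/(f)$ with $f$ of type $0$, $1$ or $2$. Let $q:V\times V\to k$ be a non-degenerate symmetric bilinear form on a finite dimensional $k$-vector space $V$, with determinant $\det(q)\in k^*/k^{*2}$. Let $M$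 be a self-dual, semisimple $k[X]$-module that is finite dimensional over $k$, with $\dim_k M=\dim_k V$, and let $F_M\in k[X]$ be its characteristic polynomial, i.e. that of multiplication by $X$ on $M$. We say that $q$ has an isometry with module $M$ if there is a $k$-linear automorphism $t$ of $V$ with $q(tx,ty)=q(x,y)$ for all $x,y\in V$ such that $V$, with $X$ acting as $t$, is isomorphic to $M$ as a $k[X]$-module. Then $q$ has an isometry with module $M$ if and only if $$\det(q)\,F_M(1)F_M(-1)\in k^2,$$ where $k^2$ is the set of squares of elements of $k$ (including $0$). If moreover $F_M(1)F_M(-1)\neq 0$, then $q$ has an isometry with module $M$ if and only if $$\det(q)=F_M(1)F_M(-1)\ \text{ in } k^*/k^{*2}.$$ -/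

import Mathlib

open Polynomial

noncomputable section

namespace QuadIsometry

universe u

/-! ### Symmetric polynomials and self-dual modules -/

section Polynomials

variable {k : Type*} [Field k]

/-- A monic polynomial `f` is `ε`-symmetric if `f(X) = ε X ^ deg f * f(X⁻¹)`;
`Polynomial.reverse f` is `X ^ deg f * f(X⁻¹)`. -/
def IsEpsSymmetric (ε : k) (f : k[X]) : Prop :=
  f.Monic ∧ f = C ε * f.reverse

/-- Monic and `ε`-symmetric for some sign `ε = ±1`. -/
def IsSignSymmetric (f : k[X]) : Prop :=
  IsEpsSymmetric 1 f ∨ IsEpsSymmetric (-1) f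

/-- `f*(X) = f(0)⁻¹ X ^ deg f * f(X⁻¹)`, used for `f(0) ≠ 0`. -/
def starPoly (f : k[X]) : k[X] :=
  C (f.eval 0)⁻¹ * f.reverse

/-- Type 0: a product of powers of `X - 1` and of `X + 1`. -/
def IsType0 (f : k[X]) : Prop :=
  IsSignSymmetric f ∧ f ∈ Submonoid.closure ({X - 1, X + 1} : Set k[X])

/-- Type 1: a product of powers of monic, symmetric, irreducible polynomials of even degree. -/
def IsType1 (f : k[X]) : Prop :=
  IsSignSymmetric f ∧
    f ∈ Submonoid.closure {g : k[X] | IsEpsSymmetric 1 g ∧ Irreducible g ∧ Even g.natDegree}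

/-- Type 2: a product of polynomials `g g*` with `g` monic, irreducible, `g(0) ≠ 0`
and `g ≠ ± g*`. -/
def IsType2 (f : k[X]) : Prop :=
  IsSignSymmetric f ∧
    f ∈ Submonoid.closure {h : k[X] | ∃ g : k[X], g.Monic ∧ Irreducible g ∧ g.eval 0 ≠ 0 ∧
      g ≠ starPoly g ∧ g ≠ -starPoly g ∧ h = g * starPoly g}

/-- A `k[X]`-module is self-dual (torsion, finitely generated) if it is a finite direct sum of
cyclic modules `k[X]/(f)` with each `f` of type 0, 1 or 2 (repetitions are allowed, so that this
covers the summands `[k[X]/(f)] ^ m`). -/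
def IsSelfDual (M : Type*) [AddCommGroup M] [Module k[X] M] : Prop :=
  ∃ (n : ℕ) (f : Fin n → k[X]),
    (∀ j, IsType0 (f j) ∨ IsType1 (f j) ∨ IsType2 (f j)) ∧
      Nonempty (M ≃ₗ[k[X]] (∀ j : Fin n, k[X] ⧸ Ideal.span {f j}))

end Polynomials

section CharPoly

variable (k : Type*) [Field k] (M : Type*) [AddCommGroup M] [Module k M] [Module k[X] M]
  [IsScalarTower k k[X] M] [Module.Finite k M]

/-- The characteristic polynomial `F_M` of a `k[X]`-module `M` that is finite dimensional
over `k`: the characteristic polynomial of multiplication by `X`. -/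
def charPoly : k[X] :=
  (Algebra.lsmul k k M (X : k[X])).charpoly

variable {k M}

theorem charPoly_congr {N : Type*} [AddCommGroup N] [Module k N] [Module k[X] N]
    [IsScalarTower k k[X] N] [Module.Finite k N] (e : M ≃ₗ[k[X]] N) :
    charPoly k M = charPoly k N := by
  unfold charPoly
  rw [← LinearEquiv.charpoly_conj (e.restrictScalars k) (Algebra.lsmul k k M (X : k[X]))]
  congr 1
  ext x
  simp [LinearEquiv.conj_apply]

theorem finite_quotient {f : k[X]} (hf : f.Monic) :
    Module.Finite k (k[X] ⧸ Ideal.span {f}) :=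
  (AdjoinRoot.powerBasis hf.ne_zero).finite

theorem charPoly_cyclic {f : k[X]} (hf : f.Monic)
    [Module.Finite k (k[X] ⧸ Ideal.span {f})] :
    charPoly k (k[X] ⧸ Ideal.span {f}) = f := by
  obtain ⟨pb, hgen, hmin⟩ : ∃ pb : PowerBasis k (k[X] ⧸ Ideal.span {f}),
      pb.gen = algebraMap k[X] _ X ∧ minpoly k pb.gen = f :=
    ⟨AdjoinRoot.powerBasis hf.ne_zero, AdjoinRoot.powerBasis_gen hf.ne_zero,
      AdjoinRoot.minpoly_powerBasis_gen_of_monic hf⟩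
  have hmul : Algebra.lsmul k k (k[X] ⧸ Ideal.span {f}) (X : k[X]) =
      Algebra.lmul k (k[X] ⧸ Ideal.span {f}) pb.gen := by
    refine LinearMap.ext fun x => ?_
    rw [hgen]
    exact Algebra.smul_def X x
  have h := charpoly_leftMulMatrix pb
  rw [hmin, Algebra.leftMulMatrix_apply, LinearMap.charpoly_toMatrix] at h
  rw [charPoly, hmul, h]

theorem charPoly_prod {N : Type*} [AddCommGroup N] [Module k N] [Module k[X] N]
    [IsScalarTower k k[X] N] [Module.Finite k N] :
    charPoly k (M × N) = charPoly k M * charPoly k N := by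
  unfold charPoly
  rw [← LinearMap.charpoly_prodMap]
  rfl

theorem charPoly_pi {n : ℕ} (f : Fin n → k[X]) (hf : ∀ j, (f j).Monic)
    [∀ j, Module.Finite k (k[X] ⧸ Ideal.span {f j})] :
    charPoly k (∀ j, k[X] ⧸ Ideal.span {f j}) = ∏ j, f j := by
  induction n with
  | zero =>
    have h := LinearMap.charpoly_natDegree
      (Algebra.lsmul k k (∀ j, k[X] ⧸ Ideal.span {f j}) (X : k[X]))
    rw [Module.finrank_zero_of_subsingleton] at h
    rw [Fin.prod_univ_zero]
    exact (LinearMap.charpoly_monic _).natDegree_eq_zero.mp h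
  | succ n ih =>
    rw [← charPoly_congr (Fin.consLinearEquiv k[X] fun j => k[X] ⧸ Ideal.span {f j}),
      charPoly_prod, charPoly_cyclic (hf 0), ih (fun j => f j.succ) fun j => hf _,
      Fin.prod_univ_succ]

/-- If `M` is the direct sum of cyclic modules `k[X]/(f_j)` with `f_j` monic, then `F_M` is the
product of the `f_j`. -/
theorem charPoly_eq_prod {n : ℕ} (f : Fin n → k[X]) (hf : ∀ j, (f j).Monic)
    (e : M ≃ₗ[k[X]] (∀ j : Fin n, k[X] ⧸ Ideal.span {f j})) :
    charPoly k M = ∏ j, f j := by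
  have := fun j => finite_quotient (hf j)
  rw [charPoly_congr e, charPoly_pi f hf]

end CharPoly

/-! ### Quadratic spaces -/

section Forms

variable {k : Type*} [Field k] {V : Type*} [AddCommGroup V] [Module k V]
  [Module.Finite k V]

/-- The square class in `kˣ / (kˣ)²` of a non-zero element. -/
def squareClass (a : kˣ) : kˣ ⧸ Subgroup.square kˣ := QuotientGroup.mk a

/-- The determinant of a non-degenerate bilinear form: the class in `kˣ / (kˣ)²` of the
determinant of a Gram matrix. -/
def detClass (q : LinearMap.BilinForm k V) (hq : q.Nondegenerate) : kˣ ⧸ Subgroup.square kˣ :=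
  squareClass (Units.mk0 (LinearMap.BilinForm.toMatrix (Module.finBasis k V) q).det
    ((LinearMap.BilinForm.nondegenerate_iff_det_ne_zero (Module.finBasis k V)).mp hq))

/-- The determinant does not depend on the choice of a basis. -/
theorem detClass_eq (q : LinearMap.BilinForm k V) (hq : q.Nondegenerate)
    {ι : Type*} [Fintype ι] [DecidableEq ι] (b : Module.Basis ι k V) :
    detClass q hq = squareClass (Units.mk0 (LinearMap.BilinForm.toMatrix b q).det
      ((LinearMap.BilinForm.nondegenerate_iff_det_ne_zero b).mp hq)) := by
  classical
  set c := Module.finBasis k V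
  have hdim : Fintype.card ι = Module.finrank k V := (Module.finrank_eq_card_basis b).symm
  let e : Fin (Module.finrank k V) ≃ ι := (Fintype.equivFinOfCardEq hdim).symm
  have hb : (LinearMap.BilinForm.toMatrix b q).det =
      (LinearMap.BilinForm.toMatrix (b.reindex e.symm) q).det := by
    rw [← Matrix.det_submatrix_equiv_self e]
    congr 1
    ext i j
    simp [LinearMap.BilinForm.toMatrix_apply]
  have hdet := congrArg Matrix.det
    (LinearMap.BilinForm.toMatrix_mul_basis_toMatrix c (b.reindex e.symm) q)
  rw [Matrix.det_mul, Matrix.det_mul, Matrix.det_transpose] at hdet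
  have h0 : (c.toMatrix (b.reindex e.symm)).det ≠ 0 := by
    intro h
    rw [h] at hdet
    exact (LinearMap.BilinForm.nondegenerate_iff_det_ne_zero (b.reindex e.symm)).mp hq
      (by rw [← hdet]; ring)
  unfold detClass squareClass
  rw [QuotientGroup.eq, Subgroup.mem_square]
  refine ⟨Units.mk0 _ h0, ?_⟩
  rw [inv_mul_eq_iff_eq_mul]
  ext
  simp only [Units.val_mk0, Units.val_mul]
  rw [hb, ← hdet]
  ring

/-- For a square class `c` in `kˣ / (kˣ)²` and `a` in `k`: the product `c * a` lies in the set
`k²` of squares of elements of `k` (including zero), that is, `d * a` is a square for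
one representative `d` of `c`, or equivalently for all of them. -/
def ClassMulIsSquare (c : kˣ ⧸ Subgroup.square kˣ) (a : k) : Prop :=
  ∃ d : kˣ, squareClass d = c ∧ IsSquare ((d : k) * a)

theorem classMulIsSquare_squareClass (d : kˣ) (a : k) :
    ClassMulIsSquare (squareClass d) a ↔ IsSquare ((d : k) * a) := by
  refine ⟨?_, fun h => ⟨d, rfl, h⟩⟩
  rintro ⟨d', hd, h⟩
  unfold squareClass at hd
  rw [QuotientGroup.eq, Subgroup.mem_square] at hd
  obtain ⟨r, hr⟩ := hd
  rw [inv_mul_eq_iff_eq_mul] at hr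
  have hs : IsSquare ((r : k) * r) := ⟨_, rfl⟩
  have hmul := hs.mul h
  have hd' : (d : k) = d' * (r * r) := by rw [hr, Units.val_mul, Units.val_mul]
  rwa [hd', mul_comm (d' : k), mul_assoc]

/-- `q` has an isometry with module `M`: there is an automorphism `t` of `V` preserving `q`
such that `V`, with `X` acting as `t`, is isomorphic to `M` as a `k[X]`-module. -/
def HasIsometryWithModule (q : LinearMap.BilinForm k V) (M : Type*) [AddCommGroup M]
    [Module k[X] M] : Prop :=
  ∃ t : V ≃ₗ[k] V, (∀ x y, q (t x) (t y) = q x y) ∧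
    Nonempty (Module.AEval' (t : V →ₗ[k] V) ≃ₗ[k[X]] M)

end Forms

/-! ### Cohomological dimension -/

/-- `cd₂(k) ≤ 1`: for `Γ` the Galois group of a separable closure of `k`, the (continuous)
cohomology `H^r(Γ, A)` vanishes for all `r > 1` and all finite discrete `Γ`-modules `A` in which
every element is killed by a power of `2`. -/
def CohomDimTwoLeOne (k : Type u) [Field k] : Prop :=
  ∀ A : TopRep.{u} ℤ Gal(SeparableClosure k/k),
    Finite A → DiscreteTopology A →
    Continuous (fun p : Gal(SeparableClosure k/k) × A => A.ρ p.1 p.2) →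
    (∀ a : A, ∃ n : ℕ, 2 ^ n • a = 0) →
    ∀ r : ℕ, 1 < r → Subsingleton (continuousCohomology r A)

end QuadIsometry

end

-- Only one consequence of `CohomDimTwoLeOne` is needed: `H²(Γ, ℤ/2) = 0`. The cup product of the
-- quadratic characters of `a` and `b` is then a coboundary, so `b` is a norm from `k(√a)` whenever
-- `a` is not a square (`exists_eq_norm_of_coboundary`). Hence every binary form represents `1`, and
-- dimension and determinant classify non-degenerate symmetric forms
-- (`BinaryUniversal.exists_isometry`). The problem becomes: which determinants occur among the
-- non-degenerate symmetric forms on `M` invariant under `X`?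
--
-- Necessity holds over any field of characteristic not `2`. For an isometry `T` of a Gram matrix
-- `Q`, the matrix `QT - TᵗQ` is skew-symmetric, so its determinant is a square. When `±1` are not
-- eigenvalues, `det T = 1` and this determinant is `det Q * F(1) * F(-1)`
-- (`isSquare_det_mul_of_isometry`).
--
-- For sufficiency, `M` carries some invariant form: by semisimplicity the defining polynomials are
-- squarefree, and the Chinese remainder theorem reduces to fields with an involution inverting `X`
-- and to hyperbolic pairs (`IsSelfDual.hasInvariantForm`). If `F(1) * F(-1) ≠ 0`, its determinant
-- is forced and agrees with that of `q`. Otherwise some eigenvector for `1` or `-1` is anisotropic,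
-- and rescaling the form along it yields any determinant (`HasInvariantForm.exists_detClass_eq`).

universe u

namespace QuadIsometry

/-! ### Continuous cohomology: cup products of characters as coboundaries -/

section Cohomology

open CategoryTheory TopRep ContRepresentation

/-- In a complex of topological modules with trivial homology, every cycle is a boundary. -/
theorem exists_of_subsingleton_homology {R : Type*} [Ring R] [TopologicalSpace R]
    (S : ShortComplex (TopModuleCat R)) [Subsingleton S.homology] (x : S.X₂)
    (hx : S.g.hom x = 0) : ∃ y : S.X₁, S.f.hom y = x := by
  let D : S.LeftHomologyData :=
    ⟨_, _, _, _, _, TopModuleCat.isLimitKer _, by simp, TopModuleCat.isColimitCoker _⟩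
  have hD : Subsingleton D.H := ((forget (TopModuleCat R)).mapIso
    D.homologyIso).toEquiv.symm.subsingleton
  let z : D.K := ⟨x, hx⟩
  have hz : D.π.hom z = 0 := Subsingleton.elim _ _
  obtain ⟨y, hy⟩ := (Submodule.Quotient.mk_eq_zero _).mp hz
  exact ⟨y, congrArg Subtype.val hy⟩

variable {G : Type u} [Group G] [TopologicalSpace G] [IsTopologicalGroup G]

/-- If `H²(G, A) = 0`, every invariant homogeneous 2-cocycle is a coboundary. -/
theorem exists_cochain_of_subsingleton (A : TopRep.{u} ℤ G)
    (h : Subsingleton (continuousCohomology 2 A))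
    (F : (resolutionX A 3)) (hF : ∀ g, (resolutionX A 3).ρ g F = F)
    (hd : (d A 3).hom F = 0) : ∃ b : resolutionX A 2, (∀ g, (resolutionX A 2).ρ g b = b) ∧
      (d A 2).hom b = F := by
  -- Homogeneous `n`-cochains have `n + 1` arguments, so degrees `1, 2, 3` of the complex are the
  -- invariants of `resolutionX A` at `2, 3, 4`.
  have e := HomologicalComplex.homologyIsoSc' (homogeneousCochains A) 1 2 3 (by simp) (by simp)
  have : Subsingleton ((homogeneousCochains A).sc' 1 2 3).homology :=
    ((forget (TopModuleCat ℤ)).mapIso e).toEquiv.symm.subsingleton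
  obtain ⟨y, hy⟩ := exists_of_subsingleton_homology ((homogeneousCochains A).sc' 1 2 3) ⟨F, hF⟩
    (Subtype.ext ((homogeneousCochains.d_apply A 2 ⟨F, hF⟩).trans hd))
  exact ⟨y.1, y.2, (homogeneousCochains.d_apply A 1 y).symm.trans (congrArg Subtype.val hy)⟩

theorem d_three_apply (A : TopRep.{u} ℤ G) (F : C(G, C(G, C(G, A)))) (w x y z : G) :
    (((d A 3).hom F : C(G, C(G, C(G, C(G, A))))) w x y) z =
      F x y z - (F w y z - (F w x z - F w x y)) := rfl

/-- The group `ZMod 2`, lifted to any universe, as a trivial topological representation. -/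
abbrev trivialTwo (G : Type u) [Group G] : TopRep.{u} ℤ G :=
  .of (.trivial ℤ G (ULift.{u} (ZMod 2)))

/-- If `H²(G, ℤ/2) = 0`, then the cup product of two characters is a coboundary. -/
theorem exists_coboundary_eq_cup (h : Subsingleton (continuousCohomology 2 (trivialTwo G)))
    (χ ψ : G → ZMod 2) (hχ : Continuous χ) (hψ : Continuous ψ)
    (hχm : ∀ x y, χ (x * y) = χ x + χ y) (hψm : ∀ x y, ψ (x * y) = ψ x + ψ y) :
    ∃ φ : G → ZMod 2, Continuous φ ∧ ∀ x y, χ x * ψ y = φ x + φ y + φ (x * y) := by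
  -- The homogeneous form of the 2-cocycle `(x, y) ↦ χ x * ψ y`.
  let c : C((G × G) × G, ULift.{u} (ZMod 2)) :=
    ⟨fun p => ULift.up (χ (p.1.1⁻¹ * p.1.2) * ψ (p.1.2⁻¹ * p.2)), by fun_prop⟩
  let F : C(G, C(G, C(G, ULift.{u} (ZMod 2)))) := c.curry.curry
  have hFa (x y z : G) : F x y z = ULift.up (χ (x⁻¹ * y) * ψ (y⁻¹ * z)) := rfl
  have hχi (x : G) : χ x⁻¹ = χ x := by
    have h1 := hχm 1 1
    have h2 := hχm x x⁻¹
    rw [mul_inv_cancel] at h2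
    rw [one_mul] at h1
    generalize χ 1 = a at *; generalize χ x = b at *; generalize χ x⁻¹ = c at *
    revert a b c; decide
  have hψi (x : G) : ψ x⁻¹ = ψ x := by
    have h1 := hψm 1 1
    have h2 := hψm x x⁻¹
    rw [mul_inv_cancel] at h2
    rw [one_mul] at h1
    generalize ψ 1 = a at *; generalize ψ x = b at *; generalize ψ x⁻¹ = c at *
    revert a b c; decide
  obtain ⟨b, hb, hdb⟩ := exists_cochain_of_subsingleton (trivialTwo G) h F (by
    intro g
    refine ContinuousMap.ext fun x => ContinuousMap.ext fun y => ContinuousMap.ext fun z => ?_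
    change F (g⁻¹ * x) (g⁻¹ * y) (g⁻¹ * z) = F x y z
    simp [hFa, mul_assoc]) (by
    refine ContinuousMap.ext fun w => ContinuousMap.ext fun x => ContinuousMap.ext fun y =>
      ContinuousMap.ext fun z => ?_
    refine (d_three_apply (trivialTwo G) F w x y z).trans ?_
    simp only [hFa, hχm, hψm, hχi, hψi]
    refine ULift.ext _ _ ?_
    change _ - (_ - (_ - _)) = (0 : ZMod 2)
    generalize χ w = a1; generalize χ x = a2; generalize χ y = a3
    generalize ψ x = b1; generalize ψ y = b2; generalize ψ z = b3
    revert a1 a2 a3 b1 b2 b3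
    decide)
  let b' : C(G, C(G, ULift.{u} (ZMod 2))) := b
  have hb' (g x y : G) : b' (g⁻¹ * x) (g⁻¹ * y) = b' x y :=
    congrArg (fun f : C(G, C(G, ULift.{u} (ZMod 2))) => f x y) (hb g)
  -- Back to inhomogeneous cochains: evaluate at `(1, x, x * y)`, where invariance turns `b' x (x *
  -- y)` into `b' 1 y`.
  refine ⟨fun x => (b' 1 x).down, by fun_prop, fun x y => ?_⟩
  have h1 : b' x (x * y) - (b' 1 (x * y) - b' 1 x) = F 1 x (x * y) := by
    rw [← hdb]; rfl
  have h2 := hb' x x (x * y)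
  rw [inv_mul_cancel, inv_mul_cancel_left] at h2
  rw [← h2, hFa] at h1
  have h3 := congrArg ULift.down h1
  simp only [inv_one, one_mul, inv_mul_cancel_left, ULift.sub_down] at h3
  rw [← h3]
  dsimp only
  generalize (b' 1 y).down = p; generalize (b' 1 x).down = q; generalize (b' 1 (x * y)).down = r
  revert p q r
  decide

end Cohomology

theorem CohomDimTwoLeOne.subsingleton_two {k : Type u} [Field k] (h : CohomDimTwoLeOne k) :
    Subsingleton (continuousCohomology 2 (trivialTwo Gal(SeparableClosure k/k))) := by
  refine h _ (inferInstanceAs (Finite (ULift (ZMod 2))))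
    (inferInstanceAs (DiscreteTopology (ULift (ZMod 2)))) continuous_snd (fun a => ⟨1, ?_⟩) 2
    one_lt_two
  refine ULift.ext _ _ ?_
  change 2 ^ 1 • (a : ULift (ZMod 2)).down = 0
  generalize (a : ULift (ZMod 2)).down = p
  revert p
  decide

end QuadIsometry
namespace QuadIsometry

/-! ### From a trivial cup product to a norm -/

section Galois

variable {k K : Type*} [Field k] [Field K] [Algebra k K]

/-- The sign `(-1) ^ x`, as an element of `K`. -/
def signTwo (K : Type*) [Field K] (x : ZMod 2) : K := if x = 0 then 1 else -1

theorem signTwo_add (x y : ZMod 2) : signTwo K (x + y) = signTwo K x * signTwo K y := by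
  have : ∀ x : ZMod 2, x = 0 ∨ x = 1 := by decide
  have h : (1 : ZMod 2) + 1 = 0 := rfl
  rcases this x with rfl | rfl <;> rcases this y with rfl | rfl <;> simp [signTwo, h]

theorem signTwo_mul_self (x : ZMod 2) : signTwo K x * signTwo K x = 1 := by
  unfold signTwo; split_ifs <;> simp

theorem map_signTwo (σ : Gal(K/k)) (x : ZMod 2) : σ (signTwo K x) = signTwo K x := by
  unfold signTwo; split_ifs <;> simp

open Classical in
/-- The quadratic character attached to a square root `α`. -/
noncomputable def sqrtChar (α : K) (σ : Gal(K/k)) : ZMod 2 := if σ α = α then 0 else 1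

theorem apply_eq_signTwo_mul {α : K} {a : k} (hα : α * α = algebraMap k K a) (σ : Gal(K/k)) :
    σ α = signTwo K (sqrtChar α σ) * α := by
  have h : σ α * σ α = α * α := by rw [← map_mul, hα, AlgEquiv.commutes]
  unfold signTwo sqrtChar
  by_cases h' : σ α = α
  · rw [if_pos h', if_pos rfl, one_mul, h']
  · rw [if_neg h', if_neg one_ne_zero, neg_one_mul]
    exact (mul_self_eq_mul_self_iff.mp h).resolve_left h'

theorem signTwo_injective (h2 : (2 : K) ≠ 0) : Function.Injective (signTwo K) := by
  have h11 : (1 : K) ≠ -1 := fun h => h2 (by linear_combination h)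
  have : ∀ x : ZMod 2, x = 0 ∨ x = 1 := by decide
  intro x y h
  rcases this x with rfl | rfl <;> rcases this y with rfl | rfl <;> simp_all [signTwo]

theorem sqrtChar_mul (h2 : (2 : K) ≠ 0) {α : K} {a : k} (hα : α * α = algebraMap k K a)
    (h0 : α ≠ 0) (σ τ : Gal(K/k)) : sqrtChar α (σ * τ) = sqrtChar α σ + sqrtChar α τ := by
  apply signTwo_injective h2
  apply mul_right_cancel₀ h0
  rw [← apply_eq_signTwo_mul hα, AlgEquiv.mul_apply, apply_eq_signTwo_mul hα τ, map_mul,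
    map_signTwo, apply_eq_signTwo_mul hα σ, signTwo_add]
  ring

theorem continuous_sqrtChar [Algebra.IsIntegral k K] (α : K) :
    Continuous (sqrtChar α : Gal(K/k) → ZMod 2) := by
  refine IsLocallyConstant.continuous ((IsLocallyConstant.iff_eventually_eq _).mpr fun σ => ?_)
  have h : IsOpen ((fun τ : Gal(K/k) => σ⁻¹ * τ) ⁻¹' (MulAction.stabilizer Gal(K/k) α)) :=
    (stabilizer_isOpen_of_isIntegral α).preimage (continuous_const_mul σ⁻¹)
  filter_upwards [h.mem_nhds (by simp)] with τ hτ
  have h1 : τ α = σ α := by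
    have : σ⁻¹ • τ • α = α := by rw [smul_smul]; exact hτ
    rw [inv_smul_eq_iff] at this
    exact this
  unfold sqrtChar
  rw [h1]

/-- A continuous character with values in `{±1}` of a closed subgroup of the Galois group comes from a
twisted fixed vector. -/
theorem exists_twisted_fixed [IsGalois k K] (N : Subgroup Gal(K/k))
    (hN : IsClosed (N : Set Gal(K/k))) (φ : Gal(K/k) → ZMod 2) (hφ : Continuous φ)
    (hm : ∀ σ ∈ N, ∀ τ, φ (σ * τ) = φ σ + φ τ) :
    ∃ z : K, z ≠ 0 ∧ ∀ σ ∈ N, σ z = signTwo K (φ σ) * z := by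
  have h01 : ∀ x : ZMod 2, x = 0 ∨ x = 1 := by decide
  have hone : φ 1 = 0 := by simpa using hm 1 N.one_mem 1
  have hinv : ∀ σ ∈ N, φ σ⁻¹ = φ σ := fun σ hσ => by
    have := hm σ hσ σ⁻¹
    rw [mul_inv_cancel, hone] at this
    revert this
    generalize φ σ = p; generalize φ σ⁻¹ = q
    revert p q; decide
  by_cases hex : ∃ ρ ∈ N, φ ρ = 1
  · obtain ⟨ρ, hρN, hρ⟩ := hex
    -- The kernel of `φ` on `N`. As `ρ` lies outside it, the Galois correspondence gives an element
    -- `y` fixed by `H` and moved by `ρ`.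
    let H : ClosedSubgroup Gal(K/k) :=
      { carrier := {σ | σ ∈ N ∧ φ σ = 0}
        mul_mem' := fun {σ τ} hσ hτ => ⟨N.mul_mem hσ.1 hτ.1, by rw [hm σ hσ.1, hσ.2, hτ.2]; rfl⟩
        one_mem' := ⟨N.one_mem, hone⟩
        inv_mem' := fun {σ} hσ => ⟨N.inv_mem hσ.1, by rw [hinv σ hσ.1, hσ.2]⟩
        isClosed' := hN.inter ((isClosed_singleton (x := (0 : ZMod 2))).preimage hφ) }
    have hmem (σ : Gal(K/k)) : σ ∈ H.toSubgroup ↔ σ ∈ N ∧ φ σ = 0 := Iff.rfl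
    have hρH : ρ ∉ H.toSubgroup := fun h => by
      have := h.2; rw [hρ] at this; exact one_ne_zero this
    rw [← InfiniteGalois.fixingSubgroup_fixedField H, IntermediateField.mem_fixingSubgroup_iff]
      at hρH
    push Not at hρH
    obtain ⟨y, hy, hne⟩ := hρH
    have hfix : ∀ σ ∈ N, φ σ = 0 → σ y = y := fun σ h1 h2 => hy ⟨σ, h1, h2⟩
    -- `H` has index two in `N`: its elements fix both `y` and `ρ y`, and the others interchange
    -- them.
    refine ⟨y - ρ y, sub_ne_zero.mpr (Ne.symm hne), fun σ hσ => ?_⟩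
    rcases h01 (φ σ) with h | h
    · have h1 : (ρ⁻¹ * σ * ρ) y = y := hfix _ (N.mul_mem (N.mul_mem (N.inv_mem hρN) hσ) hρN) (by
        rw [hm _ (N.mul_mem (N.inv_mem hρN) hσ), hm _ (N.inv_mem hρN), hinv ρ hρN, h, hρ]; rfl)
      have h2 : σ (ρ y) = ρ y := by
        have := congrArg ρ h1
        rwa [← AlgEquiv.mul_apply, mul_assoc, mul_inv_cancel_left] at this
      rw [map_sub, h2, hfix σ hσ h, h]
      simp [signTwo]
    · have h1 : (ρ⁻¹ * σ) y = y := hfix _ (N.mul_mem (N.inv_mem hρN) hσ) (by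
        rw [hm _ (N.inv_mem hρN), hinv ρ hρN, h, hρ]; rfl)
      have h2 : σ y = ρ y := by
        have := congrArg ρ h1
        rwa [← AlgEquiv.mul_apply, mul_inv_cancel_left] at this
      have h3 : σ (ρ y) = y := hfix (σ * ρ) (N.mul_mem hσ hρN) (by
        rw [hm _ hσ, h, hρ]; rfl)
      rw [map_sub, h2, h3, h]
      simp [signTwo]
  · push Not at hex
    refine ⟨1, one_ne_zero, fun σ hσ => ?_⟩
    rcases h01 (φ σ) with h | h
    · simp [h, signTwo]
    · exact absurd h (hex σ hσ)

/-- If the cup product of the quadratic characters of `a` and `b` is a coboundary, then `b` is a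
norm from `k(√a)`. -/
theorem exists_eq_norm_of_coboundary [IsGalois k K] (h2 : (2 : K) ≠ 0) {a b : k} (hb : b ≠ 0)
    (ha : ¬ IsSquare a) {α β : K} (hα : α * α = algebraMap k K a)
    (hβ : β * β = algebraMap k K b) (φ : Gal(K/k) → ZMod 2) (hφ : Continuous φ)
    (hc : ∀ σ τ : Gal(K/k), sqrtChar α σ * sqrtChar β τ = φ σ + φ τ + φ (σ * τ)) :
    ∃ x y : k, b = x ^ 2 - a * y ^ 2 := by
  have h01 : ∀ x : ZMod 2, x = 0 ∨ x = 1 := by decide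
  have hα0 : α ≠ 0 := by
    rintro rfl
    rw [mul_zero, eq_comm, map_eq_zero_iff _ (algebraMap k K).injective] at hα
    exact ha (hα ▸ IsSquare.zero)
  have hβ0 : β ≠ 0 := by
    rintro rfl
    rw [mul_zero, eq_comm, map_eq_zero_iff _ (algebraMap k K).injective] at hβ
    exact hb hβ
  have hmα := sqrtChar_mul (k := k) h2 hα hα0
  have h1 : sqrtChar α (1 : Gal(K/k)) = 0 := by simpa using hmα 1 1
  -- `N` is the Galois group over `k(√a)`. On it the cup product vanishes, so `φ` restricts to a
  -- character there.
  let N : Subgroup Gal(K/k) :=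
    { carrier := {σ | sqrtChar α σ = 0}
      mul_mem' := fun {σ τ} (hσ : _ = _) (hτ : _ = _) => by
        change _ = _
        rw [hmα, hσ, hτ]; rfl
      one_mem' := h1
      inv_mem' := fun {σ} (hσ : _ = _) => by
        have := hmα σ σ⁻¹
        rw [mul_inv_cancel, h1, hσ, zero_add] at this
        exact this.symm }
  have hNmem (σ : Gal(K/k)) : σ ∈ N ↔ sqrtChar α σ = 0 := Iff.rfl
  have hNα : ∀ σ ∈ N, σ α = α := fun σ hσ => by
    rw [apply_eq_signTwo_mul hα, (hNmem σ).mp hσ]; simp [signTwo]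
  obtain ⟨z, hz0, hz⟩ := exists_twisted_fixed N
    ((isClosed_singleton (x := (0 : ZMod 2))).preimage (continuous_sqrtChar α)) φ hφ (by
      intro σ hσ τ
      have := hc σ τ
      rw [(hNmem σ).mp hσ, zero_mul] at this
      revert this
      generalize φ σ = p; generalize φ τ = q; generalize φ (σ * τ) = r
      revert p q r; decide)
  obtain ⟨τ, hτ⟩ : ∃ τ : Gal(K/k), sqrtChar α τ = 1 := by
    by_contra hno
    push Not at hno
    have hfix : ∀ σ : Gal(K/k), σ α = α := fun σ =>
      hNα σ ((h01 _).resolve_right (hno σ))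
    obtain ⟨c, rfl⟩ := (InfiniteGalois.mem_range_algebraMap_iff_fixed α).mpr hfix
    rw [← map_mul] at hα
    exact ha ⟨c, ((algebraMap k K).injective hα).symm⟩
  have hτα : τ α = -α := by
    rw [apply_eq_signTwo_mul hα, hτ]; simp [signTwo]
  have hfixed : ∀ v : K, (∀ σ ∈ N, σ v = v) → τ v = v → ∃ c : k, algebraMap k K c = v := by
    intro v hv hτv
    refine (InfiniteGalois.mem_range_algebraMap_iff_fixed v).mpr fun σ => ?_
    rcases h01 (sqrtChar α σ) with h | h
    · exact hv σ h
    · have : (σ * τ) v = v := hv _ (by rw [hNmem, hmα, h, hτ]; rfl)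
      rwa [AlgEquiv.mul_apply, hτv] at this
  have hconj : ∀ σ ∈ N, τ⁻¹ * σ * τ ∈ N := fun σ hσ => by
    rw [hNmem, hmα, hmα, (hNmem σ).mp hσ, add_zero, ← hmα, inv_mul_cancel, h1]
  have hττ : τ * τ ∈ N := by rw [hNmem, hmα, hτ]; rfl
  have hτconj : ∀ (σ : Gal(K/k)) (w : K), σ (τ w) = τ ((τ⁻¹ * σ * τ) w) := fun σ w => by
    rw [← AlgEquiv.mul_apply, ← AlgEquiv.mul_apply]
    congr 1
    group
  -- Comparing the coboundary relation at `(σ, τ)` and at `(τ, τ⁻¹στ)` gives `χ_β σ = φ σ + φ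
  -- (τ⁻¹στ)`. So `z * τ z` transforms exactly like `β`, and their quotient `v` lies in `k`.
  have hu : ∀ σ ∈ N, σ (z * τ z) = signTwo K (sqrtChar β σ) * (z * τ z) := by
    intro σ hσ
    have e1 := hc σ τ
    have e2 := hc τ (τ⁻¹ * σ * τ)
    have e3 := sqrtChar_mul (k := k) h2 hβ hβ0
    rw [(hNmem σ).mp hσ, zero_mul] at e1
    rw [hτ, one_mul, show τ * (τ⁻¹ * σ * τ) = σ * τ by group, e3, e3] at e2
    have e4 := e3 τ⁻¹ τ
    rw [inv_mul_cancel, show sqrtChar β (1 : Gal(K/k)) = 0 by simpa using e3 1 1] at e4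
    rw [map_mul, hz σ hσ, hτconj, hz _ (hconj σ hσ), map_mul, map_signTwo]
    have e5 : sqrtChar β σ = φ σ + φ (τ⁻¹ * σ * τ) := by
      revert e1 e2 e4
      generalize φ σ = p1; generalize φ τ = p2; generalize φ (σ * τ) = p3
      generalize φ (τ⁻¹ * σ * τ) = p4; generalize sqrtChar β σ = p5
      generalize sqrtChar β τ = p6; generalize sqrtChar β τ⁻¹ = p7
      revert p1 p2 p3 p4 p5 p6 p7
      decide
    rw [e5, signTwo_add]
    ring
  have huτ : τ (z * τ z) = signTwo K (sqrtChar β τ) * (z * τ z) := by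
    have e1 := hc τ τ
    rw [hτ, one_mul] at e1
    have e2 : τ (τ z) = (τ * τ) z := rfl
    rw [map_mul, e2, hz _ hττ]
    have e5 : φ (τ * τ) = sqrtChar β τ := by
      revert e1
      generalize φ τ = p2; generalize φ (τ * τ) = p3; generalize sqrtChar β τ = p5
      revert p2 p3 p5; decide
    rw [e5]
    ring
  have hdiv : ∀ σ : Gal(K/k), σ (z * τ z) = signTwo K (sqrtChar β σ) * (z * τ z) →
      σ (z * τ z / β) = z * τ z / β := fun σ h => by
    have hs : signTwo K (sqrtChar β σ) ≠ 0 := fun h0 => by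
      have := signTwo_mul_self (K := K) (sqrtChar β σ); rw [h0, zero_mul] at this
      exact zero_ne_one this
    rw [map_div₀, h, apply_eq_signTwo_mul hβ, mul_div_mul_left _ _ hs]
  obtain ⟨v, hv⟩ := hfixed (z * τ z / β) (fun σ hσ => hdiv σ (hu σ hσ)) (hdiv τ huτ)
  have hw : ∀ σ ∈ N, σ (z * z) = z * z := fun σ hσ => by
    rw [map_mul, hz σ hσ]
    linear_combination (z * z) * signTwo_mul_self (K := K) (φ σ)
  have hw' : ∀ σ ∈ N, σ (τ (z * z)) = τ (z * z) := fun σ hσ => by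
    rw [hτconj, hw _ (hconj σ hσ)]
  have hwτ : τ (τ (z * z)) = z * z := hw _ hττ
  -- Since `z²` is fixed by `N`, it equals `x + y * α` with `x`, `y` in `k`. Its norm `x² - a * y²`
  -- is `(z * τ z)² = b * v²`.
  obtain ⟨x, hx⟩ := hfixed ((z * z + τ (z * z)) / 2)
    (fun σ hσ => by rw [map_div₀, map_add, hw σ hσ, hw' σ hσ, map_ofNat])
    (by rw [map_div₀, map_add, hwτ, map_ofNat, add_comm])
  obtain ⟨y, hy⟩ := hfixed ((z * z - τ (z * z)) / (2 * α))
    (fun σ hσ => by rw [map_div₀, map_sub, map_mul σ (2 : K) α, hw σ hσ, hw' σ hσ, map_ofNat, hNα σ hσ])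
    (by rw [map_div₀, map_sub, map_mul τ (2 : K) α, hwτ, map_ofNat, hτα, mul_neg, div_neg, ← neg_div, neg_sub])
  have hv0 : v ≠ 0 := by
    rintro rfl
    rw [map_zero, eq_comm, div_eq_zero_iff] at hv
    simp_all
  have hτz : τ (z * z) = τ z * τ z := map_mul _ _ _
  have key : algebraMap k K (b * v ^ 2) = algebraMap k K (x ^ 2 - a * y ^ 2) := by
    simp only [map_mul, map_sub, map_pow]
    rw [hx, hy, hv, ← hα, ← hβ, hτz]
    field_simp
    ring
  have key' := (algebraMap k K).injective key
  refine ⟨x / v, y / v, ?_⟩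
  field_simp
  linear_combination key'

end Galois

/-- Every binary form `⟨a, b⟩` represents `1`. -/
def BinaryUniversal (k : Type*) [Field k] : Prop :=
  ∀ a b : k, a ≠ 0 → b ≠ 0 → ∃ x y : k, a * x ^ 2 + b * y ^ 2 = 1

/-- For a non-square `a`, an equation `b = u² - a * v²` rearranges to a representation of `1` after
division by `u²`. -/
theorem CohomDimTwoLeOne.binaryUniversal {k : Type u} [Field k] (h2 : (2 : k) ≠ 0)
    (h : CohomDimTwoLeOne k) : BinaryUniversal k := by
  intro a b ha hb
  by_cases hsq : IsSquare a
  · obtain ⟨s, rfl⟩ := hsq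
    have hs : s ≠ 0 := fun h => ha (by simp [h])
    exact ⟨s⁻¹, 0, by field_simp; ring⟩
  let K := SeparableClosure k
  have h2K : (2 : K) ≠ 0 := by
    intro h0
    apply h2
    apply (algebraMap k K).injective
    rw [map_ofNat, h0, map_zero]
  have : NeZero (2 : K) := ⟨h2K⟩
  obtain ⟨α, hα⟩ := IsSepClosed.exists_eq_mul_self (algebraMap k K a)
  obtain ⟨β, hβ⟩ := IsSepClosed.exists_eq_mul_self (algebraMap k K b)
  have hα0 : α ≠ 0 := by
    rintro rfl
    rw [mul_zero, map_eq_zero_iff _ (algebraMap k K).injective] at hα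
    exact ha hα
  have hβ0 : β ≠ 0 := by
    rintro rfl
    rw [mul_zero, map_eq_zero_iff _ (algebraMap k K).injective] at hβ
    exact hb hβ
  obtain ⟨φ, hφ, hc⟩ := exists_coboundary_eq_cup h.subsingleton_two (sqrtChar α) (sqrtChar β)
    (continuous_sqrtChar α) (continuous_sqrtChar β) (sqrtChar_mul h2K hα.symm hα0)
    (sqrtChar_mul h2K hβ.symm hβ0)
  obtain ⟨u, v, huv⟩ := exists_eq_norm_of_coboundary h2K hb hsq hα.symm hβ.symm φ hφ hc
  by_cases hu : u = 0
  · subst hu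
    have hv : v ≠ 0 := by rintro rfl; apply hb; rw [huv]; ring
    -- Here `b = -a * v²`, so the form is a hyperbolic plane, and `a⁻¹` is written as a difference
    -- of two squares.
    refine ⟨(1 + a⁻¹) / 2, (1 - a⁻¹) / (2 * v), ?_⟩
    rw [huv]
    field_simp
    ring
  · refine ⟨v / u, 1 / u, ?_⟩
    rw [huv]
    field_simp
    ring

end QuadIsometry
namespace QuadIsometry

/-! ### Skew-symmetric determinants and the determinant condition -/

section Skew

variable {k : Type*} [Field k]

/-- Outside characteristic two, the determinant of a skew-symmetric matrix is a square. -/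
theorem isSquare_det_of_transpose_eq_neg (h2 : (2 : k) ≠ 0) (n : ℕ) :
    ∀ {ι : Type u} [Fintype ι] [DecidableEq ι], Fintype.card ι = n →
      ∀ A : Matrix ι ι k, A.transpose = -A → IsSquare A.det := by
  induction n using Nat.strong_induction_on with
  | _ n ih =>
  intro ι _ _ hn A hA
  have hskew (i j : ι) : A i j = -A j i := by
    have := congrFun (congrFun hA j) i
    simpa using this
  by_cases hz : A = 0
  · subst hz
    rcases isEmpty_or_nonempty ι with h | h
    · simp
    · simp
  obtain ⟨i, j, hij⟩ : ∃ i j, A i j ≠ 0 := by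
    by_contra hno
    push Not at hno
    exact hz (Matrix.ext hno)
  have hd (i : ι) : A i i = 0 := by
    have : 2 * A i i = 0 := by linear_combination hskew i i
    exact (mul_eq_zero.mp this).resolve_left h2
  have hne : i ≠ j := by rintro rfl; exact hij (hd i)
  -- The indices `i, j` are split off as a 2 × 2 block of determinant `(A i j)²`; its Schur
  -- complement is again skew-symmetric, so induction applies.
  let κ := {x : ι // x ≠ i ∧ x ≠ j}
  let f : Fin 2 ⊕ κ → ι := Sum.elim ![i, j] Subtype.val
  have hf : Function.Bijective f := by
    constructor
    · rintro (a | a) (b | b) h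
      · fin_cases a <;> fin_cases b
        · rfl
        · exact absurd h hne
        · exact absurd h.symm hne
        · rfl
      · fin_cases a <;> simp [f] at h
        · exact absurd h.symm b.2.1
        · exact absurd h.symm b.2.2
      · fin_cases b <;> simp [f] at h
        · exact absurd h a.2.1
        · exact absurd h a.2.2
      · exact congrArg _ (Subtype.ext h)
    · intro x
      by_cases h1 : x = i
      · exact ⟨Sum.inl 0, h1.symm⟩
      by_cases h3 : x = j
      · exact ⟨Sum.inl 1, h3.symm⟩
      exact ⟨Sum.inr ⟨x, h1, h3⟩, rfl⟩
  let e : Fin 2 ⊕ κ ≃ ι := Equiv.ofBijective f hf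
  set M := A.submatrix e e with hM
  have hMs (x y) : M x y = -M y x := hskew _ _
  have hMd (x) : M x x = 0 := hd _
  have h01 : M (Sum.inl 0) (Sum.inl 1) = A i j := rfl
  have hdet : (M.toBlocks₁₁).det = A i j * A i j := by
    rw [Matrix.det_fin_two]
    simp only [Matrix.toBlocks₁₁, Matrix.of_apply, hMd, hMs (Sum.inl 1), h01]
    ring
  have hu : IsUnit (M.toBlocks₁₁).det := by
    rw [hdet]; exact (mul_ne_zero hij hij).isUnit
  let : Invertible M.toBlocks₁₁ := Matrix.invertibleOfIsUnitDet _ hu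
  have ht11 : (M.toBlocks₁₁).transpose = -M.toBlocks₁₁ := Matrix.ext fun x y => hMs _ _
  have ht12 : (M.toBlocks₁₂).transpose = -M.toBlocks₂₁ := Matrix.ext fun x y => hMs _ _
  have ht21 : (M.toBlocks₂₁).transpose = -M.toBlocks₁₂ := Matrix.ext fun x y => hMs _ _
  have ht22 : (M.toBlocks₂₂).transpose = -M.toBlocks₂₂ := Matrix.ext fun x y => hMs _ _
  have hcard : Fintype.card κ < n := by
    have := Fintype.card_congr e
    rw [Fintype.card_sum, Fintype.card_fin] at this
    omega
  have hinv : (-M.toBlocks₁₁)⁻¹ = -(M.toBlocks₁₁)⁻¹ := by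
    refine Matrix.inv_eq_left_inv ?_
    rw [neg_mul_neg, Matrix.nonsing_inv_mul _ hu]
  have hS := ih _ hcard (ι := κ) rfl (M.toBlocks₂₂ - M.toBlocks₂₁ * (M.toBlocks₁₁)⁻¹ * M.toBlocks₁₂) (by
    rw [Matrix.transpose_sub, Matrix.transpose_mul, Matrix.transpose_mul,
      Matrix.transpose_nonsing_inv, ht11, ht12, ht21, ht22, hinv]
    simp only [Matrix.neg_mul, Matrix.mul_neg, neg_neg, Matrix.mul_assoc]
    abel)
  rw [← Matrix.det_submatrix_equiv_self e A, ← hM, ← Matrix.fromBlocks_toBlocks M,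
    Matrix.det_fromBlocks₁₁, Matrix.invOf_eq_nonsing_inv, hdet]
  exact IsSquare.mul ⟨_, rfl⟩ hS

/-- The determinant of a symmetric matrix `Q` with an isometry `T` such that `1` and `-1` are not
eigenvalues of `T`. -/
theorem isSquare_det_mul_of_isometry (h2 : (2 : k) ≠ 0) {ι : Type u} [Fintype ι] [DecidableEq ι]
    (Q T : Matrix ι ι k) (hQ : Q.transpose = Q) (hQ0 : Q.det ≠ 0)
    (hT : T.transpose * Q * T = Q) :
    IsSquare (Q.det * (T.charpoly.eval 1 * T.charpoly.eval (-1))) := by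
  have hc1 : T.charpoly.eval 1 = (1 - T).det := by
    rw [Matrix.eval_charpoly, map_one]
  have hc2 : T.charpoly.eval (-1) = (-1 - T).det := by
    rw [Matrix.eval_charpoly, map_neg, map_one]
  by_cases h0 : T.charpoly.eval 1 * T.charpoly.eval (-1) = 0
  · rw [h0, mul_zero]; exact IsSquare.zero
  set B := Q * T - T.transpose * Q with hB
  have hBt : B.transpose = -B := by
    rw [hB, Matrix.transpose_sub, Matrix.transpose_mul, Matrix.transpose_mul, hQ,
      Matrix.transpose_transpose]
    abel
  -- Multiplying by `T` turns `TᵗQ` into `TᵗQT = Q`, leaving `Q(T² - 1)`.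
  have hBT : B * T = Q * ((1 - T) * (-1 - T)) := by
    rw [hB, Matrix.sub_mul, hT]
    noncomm_ring
  have hdet := congrArg Matrix.det hBT
  rw [Matrix.det_mul, Matrix.det_mul, Matrix.det_mul, ← hc1, ← hc2] at hdet
  have hB0 : B.det ≠ 0 := fun h => by
    rw [h, zero_mul] at hdet
    exact mul_ne_zero hQ0 h0 hdet.symm
  -- An invertible skew-symmetric matrix has even size. This fixes the sign in the comparison of
  -- determinants giving `det T = 1`.
  have hsign : (-1 : k) ^ Fintype.card ι = 1 := by
    have := congrArg Matrix.det hBt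
    rw [Matrix.det_transpose, Matrix.det_neg] at this
    exact mul_right_cancel₀ hB0 (by rw [one_mul]; exact this.symm)
  have hT1 : T.det = 1 := by
    have h1 : T.transpose * Q * (1 - T) = -((1 - T).transpose * Q) := by
      rw [Matrix.mul_sub, hT, Matrix.transpose_sub, Matrix.transpose_one, Matrix.sub_mul]
      noncomm_ring
    have h3 := congrArg Matrix.det h1
    rw [Matrix.det_neg, Matrix.det_mul, Matrix.det_mul, Matrix.det_mul, Matrix.det_transpose,
      Matrix.det_transpose, hsign, ← hc1] at h3
    have h4 : Q.det * T.charpoly.eval 1 ≠ 0 := mul_ne_zero hQ0 (left_ne_zero_of_mul h0)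
    exact mul_right_cancel₀ h4 (by linear_combination h3)
  rw [← hdet, hT1, mul_one]
  exact isSquare_det_of_transpose_eq_neg h2 _ rfl B hBt

end Skew

/-! ### Classification of forms by dimension and determinant -/

section Classification

variable {k : Type*} [Field k]

theorem isSquare_det_mul_charpoly (h2 : (2 : k) ≠ 0) {V : Type*} [AddCommGroup V] [Module k V]
    [Module.Finite k V] (q : LinearMap.BilinForm k V) (hs : q.IsSymm) (hq : q.Nondegenerate)
    (t : V →ₗ[k] V) (ht : ∀ x y, q (t x) (t y) = q x y) :
    ClassMulIsSquare (detClass q hq) (t.charpoly.eval 1 * t.charpoly.eval (-1)) := by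
  let b := Module.finBasis k V
  rw [detClass, classMulIsSquare_squareClass, Units.val_mk0, ← LinearMap.charpoly_toMatrix t b]
  refine isSquare_det_mul_of_isometry h2 _ _ ?_
    ((LinearMap.BilinForm.nondegenerate_iff_det_ne_zero b).mp hq) ?_
  · ext i j
    simp [LinearMap.BilinForm.toMatrix_apply, hs.eq]
  · rw [← LinearMap.BilinForm.toMatrix_comp b b]
    congr 1
    exact LinearMap.ext₂ ht

theorem exists_ne_zero_of_nondegenerate (h2 : (2 : k) ≠ 0) {V : Type*} [AddCommGroup V]
    [Module k V] [Nontrivial V] (q : LinearMap.BilinForm k V) (hs : q.IsSymm)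
    (hq : q.Nondegenerate) : ∃ v, q v v ≠ 0 := by
  by_contra hno
  push Not at hno
  obtain ⟨v, hv⟩ := exists_ne (0 : V)
  refine hv (hq.1 v fun y => ?_)
  have h1 := hno (v + y)
  simp only [map_add, LinearMap.add_apply, hno, hs.eq y v] at h1
  have : 2 * q v y = 0 := by linear_combination h1
  exact (mul_eq_zero.mp this).resolve_left h2

/-- Extends a basis of the orthogonal complement of an anisotropic vector. -/
theorem exists_basis_cons {V : Type*} [AddCommGroup V] [Module k V] [Module.Finite k V]
    (q : LinearMap.BilinForm k V) {v : V} (hv : q v v ≠ 0) {n : ℕ}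
    (b : Module.Basis (Fin n) k (q.orthogonal (k ∙ v))) :
    ∃ c : Module.Basis (Fin (n + 1)) k V, c 0 = v ∧ (∀ i, c (Fin.succ i) = b i) ∧
      (LinearMap.BilinForm.toMatrix c q).det =
        q v v * (LinearMap.BilinForm.toMatrix b (q.restrict _)).det := by
  have horth (i : Fin n) : q v (b i) = 0 :=
    (b i).2 v (Submodule.mem_span_singleton_self v)
  let c : Module.Basis (Fin (n + 1)) k V := Module.Basis.mkFinCons v b (by
    intro a x hx h
    have h1 : q v (a • v + x) = 0 := by rw [h, map_zero]
    have h3 : q v x = 0 := hx v (Submodule.mem_span_singleton_self v)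
    rw [map_add, map_smul, h3, add_zero, smul_eq_mul] at h1
    exact (mul_eq_zero.mp h1).resolve_right hv) (by
    intro z
    refine ⟨-(q v z / q v v), ?_⟩
    intro w hw
    obtain ⟨r, rfl⟩ := Submodule.mem_span_singleton.mp hw
    have : q v (z + -(q v z / q v v) • v) = 0 := by
      rw [map_add, map_smul, smul_eq_mul]
      field_simp
      ring
    change q (r • v) _ = 0
    rw [map_smul, LinearMap.smul_apply, this, smul_zero])
  have hc : (c : Fin (n + 1) → V) = Fin.cons v (Subtype.val ∘ b) := Module.Basis.coe_mkFinCons ..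
  have hc0 : c 0 = v := by rw [hc]; rfl
  have hcs (i : Fin n) : c (Fin.succ i) = b i := by rw [hc]; rfl
  refine ⟨c, hc0, hcs, ?_⟩
  rw [Matrix.det_succ_row_zero, Fin.sum_univ_succ, Finset.sum_eq_zero]
  · simp only [LinearMap.BilinForm.toMatrix_apply, hc0, Fin.val_zero, pow_zero, one_mul, add_zero]
    congr 2
    ext i j
    simp [LinearMap.BilinForm.toMatrix_apply, hcs]
  · intro i _
    simp [LinearMap.BilinForm.toMatrix_apply, hc0, hcs, horth]

/-- Two orthogonal anisotropic vectors span a binary subform, which is universal. -/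
theorem BinaryUniversal.exists_eq_one (hk : BinaryUniversal k) (h2 : (2 : k) ≠ 0) {V : Type*}
    [AddCommGroup V] [Module k V] [Module.Finite k V] (q : LinearMap.BilinForm k V)
    (hs : q.IsSymm) (hq : q.Nondegenerate) (hdim : 1 < Module.finrank k V) :
    ∃ v, q v v = 1 := by
  have : Nontrivial V := Module.nontrivial_of_finrank_pos (R := k) (by omega)
  obtain ⟨v, hv⟩ := exists_ne_zero_of_nondegenerate h2 q hs hq
  have hrefl : q.IsRefl := hs.isRefl
  have hv0 : v ≠ 0 := by rintro rfl; simp at hv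
  have hfr := LinearMap.BilinForm.finrank_orthogonal hq (k ∙ v)
  rw [finrank_span_singleton hv0] at hfr
  have : Nontrivial (q.orthogonal (k ∙ v)) := Module.nontrivial_of_finrank_pos (R := k) (by omega)
  obtain ⟨w, hw⟩ := exists_ne_zero_of_nondegenerate h2 (q.restrict (q.orthogonal (k ∙ v)))
    (hs.restrict _) (q.restrict_nondegenerate_orthogonal_spanSingleton hq hrefl hv)
  have hvw : q v w = 0 := w.2 v (Submodule.mem_span_singleton_self v)
  have hwv : q w v = 0 := hrefl _ _ hvw
  obtain ⟨x, y, hxy⟩ := hk (q v v) (q w w) hv hw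
  refine ⟨x • v + y • (w : V), ?_⟩
  simp only [map_add, map_smul, LinearMap.add_apply, LinearMap.smul_apply, smul_eq_mul, hvw, hwv]
  linear_combination hxy

theorem squareClass_eq_iff (a b : kˣ) :
    squareClass a = squareClass b ↔ ∃ r : kˣ, (b : k) = a * (r * r) := by
  unfold squareClass
  rw [QuotientGroup.eq, Subgroup.mem_square]
  constructor
  · rintro ⟨r, hr⟩
    rw [inv_mul_eq_iff_eq_mul] at hr
    exact ⟨r, by rw [hr]; simp⟩
  · rintro ⟨r, hr⟩
    refine ⟨r, ?_⟩
    rw [inv_mul_eq_iff_eq_mul]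
    ext
    simpa using hr

/-- The rank-one case of the classification, where `1` need not be represented: the two Gram entries
differ by a square, absorbed by scaling the basis vector. -/
theorem exists_apply_self_eq {V : Type*} {V' : Type*} [AddCommGroup V] [Module k V]
    [Module.Finite k V] [AddCommGroup V'] [Module k V'] [Module.Finite k V']
    (q : LinearMap.BilinForm k V) (q' : LinearMap.BilinForm k V') (hq : q.Nondegenerate)
    (hq' : q'.Nondegenerate) (h : Module.finrank k V = 1) (h' : Module.finrank k V' = 1)
    (hdet : detClass q hq = detClass q' hq') : ∃ v v', q v v ≠ 0 ∧ q v v = q' v' v' := by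
  let b : Module.Basis (Fin 1) k V := Module.finBasisOfFinrankEq k V h
  let b' : Module.Basis (Fin 1) k V' := Module.finBasisOfFinrankEq k V' h'
  rw [detClass_eq q hq b, detClass_eq q' hq' b', squareClass_eq_iff] at hdet
  obtain ⟨r, hr⟩ := hdet
  rw [Units.val_mk0, Units.val_mk0, Matrix.det_fin_one, Matrix.det_fin_one,
    LinearMap.BilinForm.toMatrix_apply, LinearMap.BilinForm.toMatrix_apply] at hr
  have h0 := (LinearMap.BilinForm.nondegenerate_iff_det_ne_zero b).mp hq
  rw [Matrix.det_fin_one, LinearMap.BilinForm.toMatrix_apply] at h0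
  have hv : q ((r : k) • b 0) ((r : k) • b 0) = q (b 0) (b 0) * (r * r) := by
    rw [map_smul, map_smul, LinearMap.smul_apply, smul_eq_mul, smul_eq_mul]
    ring
  refine ⟨(r : k) • b 0, b' 0, ?_, by rw [hv, hr]⟩
  rw [hv]
  exact mul_ne_zero h0 (mul_ne_zero r.ne_zero r.ne_zero)

/-- Over a field with universal binary forms, dimension and determinant classify the
non-degenerate symmetric bilinear forms. -/
theorem BinaryUniversal.exists_bases (hk : BinaryUniversal k) (h2 : (2 : k) ≠ 0) (n : ℕ) :
    ∀ {V : Type u} {V' : Type*} [AddCommGroup V] [Module k V] [Module.Finite k V]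
      [AddCommGroup V'] [Module k V'] [Module.Finite k V']
      (q : LinearMap.BilinForm k V) (q' : LinearMap.BilinForm k V')
      (_ : q.IsSymm) (_ : q'.IsSymm) (hq : q.Nondegenerate) (hq' : q'.Nondegenerate)
      (_ : Module.finrank k V = n) (_ : Module.finrank k V' = n)
      (_ : detClass q hq = detClass q' hq'),
      ∃ (b : Module.Basis (Fin n) k V) (b' : Module.Basis (Fin n) k V'),
        ∀ i j, q (b i) (b j) = q' (b' i) (b' j) := by
  induction n with
  | zero =>
    intro V V' _ _ _ _ _ _ q q' _ _ _ _ h h' _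
    exact ⟨Module.finBasisOfFinrankEq k V h, Module.finBasisOfFinrankEq k V' h', fun i => i.elim0⟩
  | succ n ih =>
    intro V V' _ _ _ _ _ _ q q' hs hs' hq hq' h h' hdet
    have hex : ∃ v v', q v v ≠ 0 ∧ q v v = q' v' v' := by
      rcases Nat.eq_zero_or_pos n with rfl | hn
      · exact exists_apply_self_eq q q' hq hq' h h' hdet
      · obtain ⟨v, hv⟩ := hk.exists_eq_one h2 q hs hq (by omega)
        obtain ⟨v', hv'⟩ := hk.exists_eq_one h2 q' hs' hq' (by omega)
        exact ⟨v, v', by simp [hv], by rw [hv, hv']⟩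
    obtain ⟨v, v', hv, hvv'⟩ := hex
    have hv' : q' v' v' ≠ 0 := hvv' ▸ hv
    have hv0 : v ≠ 0 := by rintro rfl; simp at hv
    have hv0' : v' ≠ 0 := by rintro rfl; simp at hv'
    have hfr := LinearMap.BilinForm.finrank_orthogonal hq (k ∙ v)
    have hfr' := LinearMap.BilinForm.finrank_orthogonal hq' (k ∙ v')
    rw [finrank_span_singleton hv0, h, Nat.add_sub_cancel] at hfr
    rw [finrank_span_singleton hv0', h', Nat.add_sub_cancel] at hfr'
    have hr : q.IsRefl := hs.isRefl
    have hr' : q'.IsRefl := hs'.isRefl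
    have hqr := q.restrict_nondegenerate_orthogonal_spanSingleton hq hr hv
    have hqr' := q'.restrict_nondegenerate_orthogonal_spanSingleton hq' hr' hv'
    obtain ⟨b, b', hbb'⟩ := ih (q.restrict (q.orthogonal (k ∙ v)))
      -- The common value `q v v = q' v' v'` cancels from both determinants, so the orthogonal
      -- complements also have equal determinants.
      (q'.restrict (q'.orthogonal (k ∙ v'))) (hs.restrict _) (hs'.restrict _) hqr hqr' hfr hfr' (by
        let c := Module.finBasisOfFinrankEq k _ hfr
        let c' := Module.finBasisOfFinrankEq k _ hfr'
        obtain ⟨d, -, -, hd⟩ := exists_basis_cons q hv c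
        obtain ⟨d', -, -, hd'⟩ := exists_basis_cons q' hv' c'
        rw [detClass_eq _ hqr c, detClass_eq _ hqr' c', squareClass_eq_iff]
        rw [detClass_eq q hq d, detClass_eq q' hq' d', squareClass_eq_iff] at hdet
        obtain ⟨r, hr⟩ := hdet
        refine ⟨r, ?_⟩
        simp only [Units.val_mk0] at hr ⊢
        rw [hd, hd', ← hvv', mul_assoc] at hr
        exact mul_left_cancel₀ hv hr)
    obtain ⟨d, hd0, hds, -⟩ := exists_basis_cons q hv b
    obtain ⟨d', hd0', hds', -⟩ := exists_basis_cons q' hv' b'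
    have ho (i : Fin n) : q v (b i) = 0 := (b i).2 v (Submodule.mem_span_singleton_self v)
    have ho' (i : Fin n) : q' v' (b' i) = 0 := (b' i).2 v' (Submodule.mem_span_singleton_self v')
    refine ⟨d, d', fun i j => ?_⟩
    refine Fin.cases ?_ (fun i => ?_) i <;> refine Fin.cases ?_ (fun j => ?_) j
    · rw [hd0, hd0', hvv']
    · rw [hd0, hd0', hds, hds', ho, ho']
    · rw [hd0, hd0', hds, hds', hr _ _ (ho i), hr' _ _ (ho' i)]
    · rw [hds, hds', hds, hds']; exact hbb' i j

theorem BinaryUniversal.exists_isometry (hk : BinaryUniversal k) (h2 : (2 : k) ≠ 0)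
    {V : Type u} {V' : Type*} [AddCommGroup V] [Module k V] [Module.Finite k V]
    [AddCommGroup V'] [Module k V'] [Module.Finite k V']
    (q : LinearMap.BilinForm k V) (q' : LinearMap.BilinForm k V')
    (hs : q.IsSymm) (hs' : q'.IsSymm) (hq : q.Nondegenerate) (hq' : q'.Nondegenerate)
    (hdim : Module.finrank k V = Module.finrank k V')
    (hdet : detClass q hq = detClass q' hq') :
    ∃ e : V ≃ₗ[k] V', ∀ x y, q' (e x) (e y) = q x y := by
  obtain ⟨b, b', h⟩ := hk.exists_bases h2 _ q q' hs hs' hq hq' hdim rfl hdet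
  refine ⟨b.equiv b' (Equiv.refl _), fun x y => ?_⟩
  have : q'.comp (b.equiv b' (Equiv.refl _)).toLinearMap (b.equiv b' (Equiv.refl _)).toLinearMap
      = q := by
    refine LinearMap.BilinForm.ext_basis b fun i j => ?_
    simp [h]
  exact congrArg (fun B : LinearMap.BilinForm k V => B x y) this

end Classification
end QuadIsometry
namespace QuadIsometry

/-! ### Constructions of invariant forms -/

section InvariantForms

variable (k : Type*) [Field k]

/-- There is a non-degenerate symmetric bilinear form on `M` for which `X` is an isometry. -/
def HasInvariantForm (M : Type*) [AddCommGroup M] [Module k M] [Module k[X] M] : Prop :=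
  ∃ B : LinearMap.BilinForm k M, B.IsSymm ∧ B.Nondegenerate ∧
    ∀ x y : M, B ((X : k[X]) • x) ((X : k[X]) • y) = B x y

variable {k}

theorem nondegenerate_of_isSymm {M : Type*} [AddCommGroup M] [Module k M]
    {B : LinearMap.BilinForm k M} (hB : B.IsSymm) (h : ∀ x, (∀ y, B x y = 0) → x = 0) :
    B.Nondegenerate :=
  ⟨h, fun x hx => h x fun y => hB.isRefl _ _ (hx y)⟩

variable {M N : Type*} [AddCommGroup M] [Module k M] [Module k[X] M]
  [AddCommGroup N] [Module k N] [Module k[X] N]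

theorem HasInvariantForm.of_equiv [IsScalarTower k k[X] M] [IsScalarTower k k[X] N]
    (h : HasInvariantForm k N) (e : M ≃ₗ[k[X]] N) : HasInvariantForm k M := by
  obtain ⟨B, hs, hn, hX⟩ := h
  let e' : M ≃ₗ[k] N := e.restrictScalars k
  have hs' : (B.comp (e' : M →ₗ[k] N) (e' : M →ₗ[k] N)).IsSymm := ⟨fun x y => hs.eq _ _⟩
  refine ⟨B.comp (e' : M →ₗ[k] N) (e' : M →ₗ[k] N), hs',
    nondegenerate_of_isSymm hs' fun x hx => ?_, fun x y => ?_⟩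
  · refine e.injective ?_
    rw [map_zero]
    refine hn.1 _ fun y => ?_
    have := hx (e.symm y)
    rwa [LinearMap.BilinForm.comp_apply, LinearEquiv.coe_coe, show e' (e.symm y) = y from
      e.apply_symm_apply y] at this
  · change B (e _) (e _) = B (e _) (e _)
    rw [e.map_smul, e.map_smul, hX]

theorem HasInvariantForm.pi {n : ℕ} {M : Fin n → Type*} [∀ i, AddCommGroup (M i)]
    [∀ i, Module k (M i)] [∀ i, Module k[X] (M i)] (h : ∀ i, HasInvariantForm k (M i)) :
    HasInvariantForm k (∀ i, M i) := by
  choose B hs hn hX using h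
  let C : LinearMap.BilinForm k (∀ i, M i) :=
    ∑ i, (B i).comp (LinearMap.proj i) (LinearMap.proj i)
  have hC (x y : ∀ i, M i) : C x y = ∑ i, B i (x i) (y i) := by
    simp [C, LinearMap.sum_apply]
  have hCs : C.IsSymm := ⟨fun x y => by
    rw [hC, hC]; exact Finset.sum_congr rfl fun i _ => (hs i).eq _ _⟩
  refine ⟨C, hCs, nondegenerate_of_isSymm hCs fun x hx => funext fun i => ?_, fun x y => ?_⟩
  · refine (hn i).1 _ fun y => ?_
    have := hx (Pi.single i y)
    rw [hC, Finset.sum_eq_single i, Pi.single_eq_same] at this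
    · exact this
    · intro j _ hj
      rw [Pi.single_eq_of_ne hj, map_zero]
    · simp
  · rw [hC, hC]
    exact Finset.sum_congr rfl fun i _ => hX i _ _

theorem HasInvariantForm.prod (hM : HasInvariantForm k M) (hN : HasInvariantForm k N) :
    HasInvariantForm k (M × N) := by
  obtain ⟨B, hs, hn, hX⟩ := hM
  obtain ⟨B', hs', hn', hX'⟩ := hN
  let C : LinearMap.BilinForm k (M × N) :=
    B.comp (LinearMap.fst k M N) (LinearMap.fst k M N) +
      B'.comp (LinearMap.snd k M N) (LinearMap.snd k M N)
  have hC (x y : M × N) : C x y = B x.1 y.1 + B' x.2 y.2 := rfl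
  have hCs : C.IsSymm := ⟨fun x y => by
    rw [hC, hC]; exact congrArg₂ _ (hs.eq _ _) (hs'.eq _ _)⟩
  refine ⟨C, hCs, nondegenerate_of_isSymm hCs fun x hx => Prod.ext ?_ ?_, fun x y => ?_⟩
  · refine hn.1 _ fun y => ?_
    simpa [hC] using hx (y, 0)
  · refine hn'.1 _ fun y => ?_
    simpa [hC] using hx (0, y)
  · rw [hC, hC]
    exact congrArg₂ _ (hX _ _) (hX' _ _)

theorem HasInvariantForm.of_subsingleton [Subsingleton M] : HasInvariantForm k M :=
  ⟨0, ⟨fun _ _ => rfl⟩, nondegenerate_of_isSymm ⟨fun _ _ => rfl⟩ fun _ _ => Subsingleton.elim _ _,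
    fun _ _ => rfl⟩

/-- Any functional non-zero at `1` makes `s (x * y)` non-degenerate. It stands in for the trace,
which vanishes on inseparable extensions. -/
theorem exists_functional_one (k K : Type*) [Field k] [Field K] [Algebra k K] :
    ∃ s : K →ₗ[k] k, s 1 = 1 := by
  obtain ⟨s, hs⟩ := (Algebra.linearMap k K).exists_leftInverse_of_injective
    (LinearMap.ker_eq_bot.mpr (algebraMap k K).injective)
  exact ⟨s, by simpa using DFunLike.congr_fun hs 1⟩

/-- The trace form `s (x * bar y)` on a field with involution. -/
theorem HasInvariantForm.of_involution (h2 : (2 : k) ≠ 0) {K : Type*} [Field K] [Algebra k K]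
    (e : M ≃ₗ[k] K) (r : K) (he : ∀ x, e ((X : k[X]) • x) = r * e x) (bar : K →ₐ[k] K)
    (hbar : ∀ x, bar (bar x) = x) (hr : r * bar r = 1) : HasInvariantForm k M := by
  obtain ⟨s₀, hs₀⟩ := exists_functional_one k K
  -- Symmetrising makes `s` invariant under `bar`, hence the form symmetric; `s 1 = 2` remains
  -- non-zero.
  let s : K →ₗ[k] k := s₀ + s₀.comp bar.toLinearMap
  have hsb (x : K) : s (bar x) = s x := by
    simp [s, hbar, add_comm]
  have hs1 : s 1 ≠ 0 := by
    simp only [s, LinearMap.add_apply, LinearMap.comp_apply, AlgHom.toLinearMap_apply, map_one, hs₀]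
    rwa [one_add_one_eq_two]
  let B : LinearMap.BilinForm k M :=
    ((LinearMap.mul k K).compr₂ s).compl₁₂ (e : M →ₗ[k] K) (bar.toLinearMap ∘ₗ (e : M →ₗ[k] K))
  have hB (x y : M) : B x y = s (e x * bar (e y)) := rfl
  have hBs : B.IsSymm := ⟨fun x y => by
    rw [hB, hB, ← hsb, map_mul bar, hbar, mul_comm]⟩
  refine ⟨B, hBs, nondegenerate_of_isSymm hBs fun x hx => ?_, fun x y => ?_⟩
  · by_contra h0
    have he0 : e x ≠ 0 := by simpa using h0
    have := hx (e.symm (bar (e x)⁻¹))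
    rw [hB, LinearEquiv.apply_symm_apply, hbar, mul_inv_cancel₀ he0] at this
    exact hs1 this
  · rw [hB, hB, he, he, map_mul bar]
    refine congrArg s ?_
    linear_combination (e x * bar (e y)) * hr

/-- The hyperbolic form on a pair of modules which are dual to each other. -/
theorem HasInvariantForm.hyperbolic {K : Type*} [Field K] [Algebra k K]
    (e : M ≃ₗ[k] K) (e' : N ≃ₗ[k] K) (r r' : K) (he : ∀ x, e ((X : k[X]) • x) = r * e x)
    (he' : ∀ x, e' ((X : k[X]) • x) = r' * e' x) (hr : r * r' = 1) :
    HasInvariantForm k (M × N) := by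
  obtain ⟨s, hs⟩ := exists_functional_one k K
  let D : M →ₗ[k] N →ₗ[k] k :=
    ((LinearMap.mul k K).compr₂ s).compl₁₂ (e : M →ₗ[k] K) (e' : N →ₗ[k] K)
  have hD (x : M) (y : N) : D x y = s (e x * e' y) := rfl
  let B : LinearMap.BilinForm k (M × N) :=
    D.compl₁₂ (LinearMap.fst k M N) (LinearMap.snd k M N) +
      (D.compl₁₂ (LinearMap.fst k M N) (LinearMap.snd k M N)).flip
  have hB (x y : M × N) : B x y = s (e x.1 * e' y.2) + s (e y.1 * e' x.2) := rfl
  have hBs : B.IsSymm := ⟨fun x y => by rw [hB, hB, add_comm]⟩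
  refine ⟨B, hBs, nondegenerate_of_isSymm hBs fun x hx => Prod.ext ?_ ?_, fun x y => ?_⟩
  · by_contra h0
    have he0 : e x.1 ≠ 0 := by simpa using h0
    have := hx (0, e'.symm (e x.1)⁻¹)
    simp [hB, mul_inv_cancel₀ he0, hs] at this
  · by_contra h0
    have he0 : e' x.2 ≠ 0 := by simpa using h0
    have := hx (e.symm (e' x.2)⁻¹, 0)
    simp [hB, inv_mul_cancel₀ he0, hs] at this
  · rw [hB, hB]
    simp only [Prod.smul_fst, Prod.smul_snd, he, he']
    refine congrArg₂ (· + ·) (congrArg s ?_) (congrArg s ?_)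
    · linear_combination (e x.1 * e' y.2) * hr
    · linear_combination (e y.1 * e' x.2) * hr

end InvariantForms

/-! ### Invariant forms on semisimple self-dual modules -/

section Cyclic

variable {k : Type*} [Field k]

/-- The quotient `k[X]/(f)`, viewed as `AdjoinRoot f`. -/
noncomputable def quotientEquivAdjoinRoot (f : k[X]) : (k[X] ⧸ Ideal.span {f}) ≃ₗ[k] AdjoinRoot f :=
  LinearEquiv.refl k (AdjoinRoot f)

theorem quotientEquivAdjoinRoot_X_smul (f : k[X]) (x : k[X] ⧸ Ideal.span {f}) :
    quotientEquivAdjoinRoot f ((X : k[X]) • x) =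
      AdjoinRoot.root f * quotientEquivAdjoinRoot f x :=
  Algebra.smul_def (X : k[X]) x

/-- As the inverse of the root is again a root, sending the root to its inverse defines an
involution of `k[X]/(g)`, possibly the identity. -/
theorem hasInvariantForm_of_aeval_inv (h2 : (2 : k) ≠ 0) {g : k[X]} [Fact (Irreducible g)]
    (h0 : AdjoinRoot.root g ≠ 0) (hg : aeval (AdjoinRoot.root g)⁻¹ g = 0) :
    HasInvariantForm k (k[X] ⧸ Ideal.span {g}) := by
  let bar : AdjoinRoot g →ₐ[k] AdjoinRoot g :=
    AdjoinRoot.liftAlgHom g (Algebra.ofId k _) (AdjoinRoot.root g)⁻¹ hg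
  have hbr : bar (AdjoinRoot.root g) = (AdjoinRoot.root g)⁻¹ := AdjoinRoot.liftAlgHom_root ..
  refine .of_involution h2 (quotientEquivAdjoinRoot g) (AdjoinRoot.root g)
    (quotientEquivAdjoinRoot_X_smul g) bar (fun x => ?_) (by rw [hbr, mul_inv_cancel₀ h0])
  have : bar.comp bar = AlgHom.id k _ := AdjoinRoot.algHom_ext (by
    simp [hbr])
  exact DFunLike.congr_fun this x

theorem aeval_root_self (g : k[X]) : aeval (AdjoinRoot.root g) g = 0 :=
  (AdjoinRoot.aeval_eq g).trans AdjoinRoot.mk_self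

theorem root_ne_zero {g : k[X]} [Fact (Irreducible g)] (h : g.eval 0 ≠ 0) :
    AdjoinRoot.root g ≠ 0 := by
  intro h0
  have h1 := aeval_root_self g
  rw [h0, ← map_zero (algebraMap k _), aeval_algebraMap_apply_eq_algebraMap_eval] at h1
  exact h ((algebraMap k (AdjoinRoot g)).injective h1)

theorem aeval_inv_reverse {K : Type*} [Field K] [Algebra k K] {x : K} (hx : x ≠ 0) {g : k[X]}
    (hg : aeval x g = 0) : aeval x⁻¹ g.reverse = 0 := by
  let : Invertible x := invertibleOfNonzero hx
  have := (eval₂_reverse_eq_zero_iff (algebraMap k K) x g).mpr hg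
  rwa [invOf_eq_inv] at this

theorem hasInvariantForm_X_sub_C (h2 : (2 : k) ≠ 0) (a : k) (ha : a * a = 1) :
    HasInvariantForm k (k[X] ⧸ Ideal.span {X - C a}) := by
  have : Fact (Irreducible (X - C a)) := ⟨irreducible_X_sub_C a⟩
  have hr : AdjoinRoot.root (X - C a) = algebraMap k _ a := by
    have := aeval_root_self (X - C a)
    rwa [map_sub, aeval_X, aeval_C, sub_eq_zero] at this
  have h1 : AdjoinRoot.root (X - C a) * AdjoinRoot.root (X - C a) = 1 := by
    rw [hr, ← map_mul, ha, map_one]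
  refine hasInvariantForm_of_aeval_inv h2 (left_ne_zero_of_mul_eq_one h1) ?_
  rw [inv_eq_of_mul_eq_one_left h1]
  exact aeval_root_self _

theorem eval_zero_ne_zero_of_isEpsSymmetric {ε : k} (hε : ε ≠ 0) {g : k[X]}
    (hg : IsEpsSymmetric ε g) : g.eval 0 ≠ 0 := by
  rw [hg.2, eval_mul, eval_C, ← coeff_zero_eq_eval_zero, coeff_zero_reverse, hg.1.leadingCoeff,
    mul_one]
  exact hε

theorem hasInvariantForm_of_isEpsSymmetric (h2 : (2 : k) ≠ 0) {g : k[X]}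
    (hg : IsEpsSymmetric 1 g) (hi : Irreducible g) : HasInvariantForm k (k[X] ⧸ Ideal.span {g}) := by
  have : Fact (Irreducible g) := ⟨hi⟩
  have h0 := root_ne_zero (eval_zero_ne_zero_of_isEpsSymmetric one_ne_zero hg)
  refine hasInvariantForm_of_aeval_inv h2 h0 ?_
  have h1 := aeval_inv_reverse h0 (aeval_root_self g)
  have h3 : g.reverse = g := by simpa using hg.2.symm
  rwa [h3] at h1

/-- The Chinese remainder isomorphism, as an isomorphism of modules. -/
noncomputable def quotientSpanMulEquiv {f g : k[X]} (h : IsCoprime f g) :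
    (k[X] ⧸ Ideal.span {f * g}) ≃ₗ[k[X]] (k[X] ⧸ Ideal.span {f}) × (k[X] ⧸ Ideal.span {g}) :=
  let e := (Ideal.quotEquivOfEq (Ideal.span_singleton_mul_span_singleton f g).symm).trans
    (Ideal.quotientMulEquivQuotientProd (Ideal.span {f}) (Ideal.span {g})
      ((Ideal.isCoprime_span_singleton_iff f g).mpr h))
  e.toAddEquiv.toLinearEquiv fun r x => by
    have hx : r • x = algebraMap k[X] _ r * x := Algebra.smul_def r x
    have he : r • e x = e (algebraMap k[X] _ r) * e x := Algebra.smul_def r (e x)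
    change e (r • x) = r • e x
    rw [hx, he, map_mul]

theorem natDegree_starPoly {g : k[X]} (h0 : g.eval 0 ≠ 0) :
    (starPoly g).natDegree = g.natDegree := by
  rw [starPoly, natDegree_C_mul (inv_ne_zero h0), reverse_natDegree,
    natTrailingDegree_eq_zero.mpr (Or.inr (by rwa [coeff_zero_eq_eval_zero])), Nat.sub_zero]

/-- The module splits as `k[X]/(g) × k[X]/(g*)`. Both factors are identified with the field
`AdjoinRoot g`, where `X` acts by mutually inverse elements, so the hyperbolic form applies. -/
theorem hasInvariantForm_mul_starPoly {g : k[X]} (hi : Irreducible g) (h0 : g.eval 0 ≠ 0)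
    (hsq : Squarefree (g * starPoly g)) :
    HasInvariantForm k (k[X] ⧸ Ideal.span {g * starPoly g}) := by
  have : Fact (Irreducible g) := ⟨hi⟩
  have hr := root_ne_zero h0
  have hs0 : starPoly g ≠ 0 := right_ne_zero_of_mul hsq.ne_zero
  have hcop : IsCoprime g (starPoly g) := (squarefree_mul_iff.mp hsq).1.isCoprime
  have hroot : aeval (AdjoinRoot.root g)⁻¹ (starPoly g) = 0 := by
    rw [starPoly, map_mul, aeval_inv_reverse hr (aeval_root_self g), mul_zero]
  let bar : AdjoinRoot (starPoly g) →ₐ[k] AdjoinRoot g :=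
    AdjoinRoot.liftAlgHom (starPoly g) (Algebra.ofId k _) (AdjoinRoot.root g)⁻¹ hroot
  have hbr : bar (AdjoinRoot.root (starPoly g)) = (AdjoinRoot.root g)⁻¹ :=
    AdjoinRoot.liftAlgHom_root ..
  have hfin : Module.Finite k (AdjoinRoot g) := (AdjoinRoot.powerBasis hi.ne_zero).finite
  have hfin' : Module.Finite k (AdjoinRoot (starPoly g)) := (AdjoinRoot.powerBasis hs0).finite
  have hsurj : Function.Surjective bar := by
    rw [← AlgHom.range_eq_top, eq_top_iff, ← AdjoinRoot.adjoinRoot_eq_top]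
    refine Algebra.adjoin_le (Set.singleton_subset_iff.mpr ?_)
    -- A subalgebra of an algebraic field extension is closed under inverses, so the image contains
    -- the root itself.
    have hmem : (AdjoinRoot.root g)⁻¹ ∈ bar.range := ⟨_, hbr⟩
    have := Subalgebra.inv_mem_of_algebraic (A := bar.range) (x := ⟨_, hmem⟩)
      (Algebra.IsAlgebraic.isAlgebraic (R := k) (AdjoinRoot.root g)⁻¹)
    simpa using this
  have hdim : Module.finrank k (AdjoinRoot (starPoly g)) = Module.finrank k (AdjoinRoot g) := by
    rw [(AdjoinRoot.powerBasis hs0).finrank, (AdjoinRoot.powerBasis hi.ne_zero).finrank,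
      AdjoinRoot.powerBasis_dim, AdjoinRoot.powerBasis_dim, natDegree_starPoly h0]
  have hinj : Function.Injective bar :=
    (LinearMap.injective_iff_surjective_of_finrank_eq_finrank (f := bar.toLinearMap) hdim).mpr hsurj
  let e' := (quotientEquivAdjoinRoot (starPoly g)).trans
    (LinearEquiv.ofBijective bar.toLinearMap ⟨hinj, hsurj⟩)
  refine HasInvariantForm.of_equiv (HasInvariantForm.hyperbolic (quotientEquivAdjoinRoot g) e'
    (AdjoinRoot.root g) (AdjoinRoot.root g)⁻¹ (quotientEquivAdjoinRoot_X_smul g) (fun x => ?_)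
    (mul_inv_cancel₀ hr)) (quotientSpanMulEquiv hcop)
  change bar (quotientEquivAdjoinRoot _ _) = _ * bar (quotientEquivAdjoinRoot _ _)
  rw [quotientEquivAdjoinRoot_X_smul, map_mul, hbr]

/-- Factors of a squarefree product are coprime, so the Chinese remainder theorem gives an
orthogonal sum and repeated factors never arise. -/
theorem hasInvariantForm_of_mem_closure {S : Set k[X]}
    (hS : ∀ h ∈ S, Squarefree h → HasInvariantForm k (k[X] ⧸ Ideal.span {h})) {f : k[X]}
    (hf : f ∈ Submonoid.closure S) (hsq : Squarefree f) :
    HasInvariantForm k (k[X] ⧸ Ideal.span {f}) := by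
  induction hf using Submonoid.closure_induction with
  | mem x hx => exact hS x hx hsq
  | one =>
    have : Subsingleton (k[X] ⧸ Ideal.span {(1 : k[X])}) :=
      Ideal.Quotient.subsingleton_iff.mpr (by simp)
    exact .of_subsingleton
  | mul x y _ _ hx hy =>
    obtain ⟨hrel, hsx, hsy⟩ := squarefree_mul_iff.mp hsq
    exact ((hx hsx).prod (hy hsy)).of_equiv (quotientSpanMulEquiv hrel.isCoprime)

theorem hasInvariantForm_quotient (h2 : (2 : k) ≠ 0) {f : k[X]}
    (hf : IsType0 f ∨ IsType1 f ∨ IsType2 f) (hsq : Squarefree f) :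
    HasInvariantForm k (k[X] ⧸ Ideal.span {f}) := by
  rcases hf with hf | hf | hf
  · refine hasInvariantForm_of_mem_closure (fun h hh _ => ?_) hf.2 hsq
    rcases hh with rfl | rfl
    · have := hasInvariantForm_X_sub_C h2 1 (by ring)
      rwa [C_1] at this
    · have := hasInvariantForm_X_sub_C h2 (-1) (by ring)
      rwa [C_neg, C_1, sub_neg_eq_add] at this
  · exact hasInvariantForm_of_mem_closure
      (fun h hh _ => hasInvariantForm_of_isEpsSymmetric h2 hh.1 hh.2.1) hf.2 hsq
  · refine hasInvariantForm_of_mem_closure (fun h hh hs => ?_) hf.2 hsq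
    obtain ⟨g, -, hi, h0, -, -, rfl⟩ := hh
    exact hasInvariantForm_mul_starPoly hi h0 hs

/-- The annihilator of a semisimple module is a radical ideal, and here it is `(f)`. -/
theorem squarefree_of_isSemisimpleModule {f : k[X]} (hf : f ≠ 0)
    (h : IsSemisimpleModule k[X] (k[X] ⧸ Ideal.span {f})) : Squarefree f := by
  have := IsSemisimpleModule.annihilator_isRadical (M := k[X] ⧸ Ideal.span {f}) k[X]
  rw [Ideal.annihilator_quotient, ← isRadical_iff_span_singleton,
    isRadical_iff_squarefree_of_ne_zero hf] at this
  exact this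

theorem IsSelfDual.hasInvariantForm (h2 : (2 : k) ≠ 0) {M : Type*} [AddCommGroup M] [Module k M]
    [Module k[X] M] [IsScalarTower k k[X] M] (hM : IsSelfDual (k := k) M)
    (hss : IsSemisimpleModule k[X] M) : HasInvariantForm k M := by
  obtain ⟨n, f, hf, ⟨e⟩⟩ := hM
  refine HasInvariantForm.of_equiv (.pi fun j => ?_) e
  have hss' : IsSemisimpleModule k[X] (∀ j : Fin n, k[X] ⧸ Ideal.span {f j}) := .congr e.symm
  have hj : IsSemisimpleModule k[X] (k[X] ⧸ Ideal.span {f j}) :=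
    .of_surjective (LinearMap.proj j : (∀ j : Fin n, k[X] ⧸ Ideal.span {f j}) →ₗ[k[X]] _)
      (Function.surjective_eval j)
  have hsign : IsSignSymmetric (f j) := by
    rcases hf j with h | h | h <;> exact h.1
  have hne : f j ≠ 0 := by
    rcases hsign with h | h <;> exact h.1.ne_zero
  exact hasInvariantForm_quotient h2 (hf j) (squarefree_of_isSemisimpleModule hne hj)

end Cyclic

end QuadIsometry
namespace QuadIsometry

/-! ### Adjusting the determinant and realizing the module -/

section Realization

variable {k : Type*} [Field k] {M : Type*} [AddCommGroup M] [Module k M] [Module k[X] M]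
  [IsScalarTower k k[X] M] [Module.Finite k M]

/-- Semisimplicity gives the `ε`-eigenspace a stable complement, and the two are orthogonal. If all
eigenvectors were isotropic, polarization would put them in the radical of `B`. -/
theorem exists_eigenvector_apply_self_ne_zero (h2 : (2 : k) ≠ 0) (hss : IsSemisimpleModule k[X] M)
    {B : LinearMap.BilinForm k M} (hs : B.IsSymm) (hn : B.Nondegenerate)
    (hX : ∀ x y : M, B ((X : k[X]) • x) ((X : k[X]) • y) = B x y) {ε : k} (hε : ε * ε = 1)
    (hF : (charPoly k M).eval ε = 0) :
    ∃ v : M, (X : k[X]) • v = ε • v ∧ B v v ≠ 0 := by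
  have heig : Module.End.HasEigenvalue (Algebra.lsmul k k M (X : k[X])) ε :=
    (Module.End.hasEigenvalue_iff_isRoot_charpoly _ _).mpr hF
  obtain ⟨v, hv⟩ := heig.exists_hasEigenvector
  have hvX : (X : k[X]) • v = ε • v := hv.apply_eq_smul
  by_contra hno
  push Not at hno
  let N : Submodule k[X] M := LinearMap.ker (LinearMap.lsmul k[X] M (X - C ε))
  have hsub (x : M) : (X - C ε) • x = (X : k[X]) • x - ε • x := by
    rw [sub_smul, ← algebraMap_eq, algebraMap_smul]
  have hNmem (x : M) : x ∈ N ↔ (X : k[X]) • x = ε • x := by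
    rw [LinearMap.mem_ker, LinearMap.lsmul_apply, hsub, sub_eq_zero]
  obtain ⟨P, hP⟩ := exists_isCompl N
  refine hv.2 (hn.1 v fun y => ?_)
  obtain ⟨n, hn', p, hp, rfl⟩ := Submodule.mem_sup.mp
    (show y ∈ N ⊔ P from hP.sup_eq_top ▸ Submodule.mem_top)
  have hvn : B v n = 0 := by
    have h1 := hno (v + n) (by rw [smul_add, smul_add, hvX, (hNmem n).mp hn'])
    have h3 : B n v = B v n := hs.eq _ _
    simp only [map_add, LinearMap.add_apply, hno v hvX, hno n ((hNmem n).mp hn')] at h1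
    have : 2 * B v n = 0 := by rw [h3] at h1; linear_combination h1
    exact (mul_eq_zero.mp this).resolve_left h2
  have hvp : B v p = 0 := by
    have hfinP : Module.Finite k P :=
      Module.Finite.of_injective (P.subtype.restrictScalars k) P.subtype_injective
    let f : P →ₗ[k] P := (LinearMap.lsmul k[X] P (X - C ε)).restrictScalars k
    have hf : Function.Injective f := by
      rw [injective_iff_map_eq_zero]
      intro x hx
      have hxN : (x : M) ∈ N := congrArg Subtype.val hx
      exact Subtype.ext (Submodule.disjoint_def.mp hP.disjoint _ hxN x.2)
    -- `X - ε` is bijective on the complement, and invariance with `ε² = 1` makes an eigenvector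
    -- orthogonal to its image.
    obtain ⟨w, hw⟩ := LinearMap.injective_iff_surjective.mp hf ⟨p, hp⟩
    have hw' : (X - C ε) • (w : M) = p := congrArg Subtype.val hw
    have h1 := hX v w
    rw [hvX, LinearMap.BilinForm.smul_left] at h1
    rw [← hw', hsub, map_sub, LinearMap.BilinForm.smul_right]
    linear_combination (-B v ((X : k[X]) • (w : M))) * hε + ε * h1
  rw [map_add, hvn, hvp, add_zero]

theorem det_mul_eq_of_submatrix_eq {n : ℕ} {A A' : Matrix (Fin (n + 1)) (Fin (n + 1)) k}
    (h : ∀ j : Fin n, A 0 j.succ = 0) (h' : ∀ j : Fin n, A' 0 j.succ = 0)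
    (hsub : A.submatrix Fin.succ Fin.succ = A'.submatrix Fin.succ Fin.succ) :
    A'.det * A 0 0 = A.det * A' 0 0 := by
  have key (D : Matrix (Fin (n + 1)) (Fin (n + 1)) k) (hD : ∀ j : Fin n, D 0 j.succ = 0) :
      D.det = D 0 0 * (D.submatrix Fin.succ Fin.succ).det := by
    rw [Matrix.det_succ_row_zero, Fin.sum_univ_succ, Finset.sum_eq_zero]
    · simp [Fin.succAbove_zero]
    · intro i _
      rw [hD]; ring
  rw [key A h, key A' h', hsub]
  ring

/-- If `1` or `-1` is an eigenvalue of `X`, the determinant of an invariant form can be changed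
at will. -/
theorem HasInvariantForm.exists_detClass_eq (h2 : (2 : k) ≠ 0) (h : HasInvariantForm k M)
    (hss : IsSemisimpleModule k[X] M) {ε : k} (hε : ε * ε = 1) (hF : (charPoly k M).eval ε = 0)
    (d : kˣ ⧸ Subgroup.square kˣ) :
    ∃ (B : LinearMap.BilinForm k M) (hB : B.Nondegenerate), B.IsSymm ∧
      (∀ x y : M, B ((X : k[X]) • x) ((X : k[X]) • y) = B x y) ∧ detClass B hB = d := by
  obtain ⟨B, hs, hn, hX⟩ := h
  obtain ⟨v, hvX, hv⟩ := exists_eigenvector_apply_self_ne_zero h2 hss hs hn hX hε hF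
  obtain ⟨d, rfl⟩ := QuotientGroup.mk_surjective d
  obtain ⟨c, hc0, hcs, -⟩ := exists_basis_cons B hv
    (Module.finBasis k (B.orthogonal (k ∙ v)))
  have horth (i) : B v (c (Fin.succ i)) = 0 := by
    rw [hcs]
    exact (Module.finBasis k (B.orthogonal (k ∙ v)) i).2 v (Submodule.mem_span_singleton_self v)
  have hdet := (LinearMap.BilinForm.nondegenerate_iff_det_ne_zero c).mp hn
  set δ := (LinearMap.BilinForm.toMatrix c B).det with hδ
  -- Adding `l * B v x * B v y` changes `B` only along `v`, whose value is multiplied by `d * δ`.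
  -- The determinant becomes `d * δ²`, of class `d`. Invariance survives because `B v (X • x) = ε *
  -- B v x`.
  let l : k := (d * δ - 1) / B v v
  let B' : LinearMap.BilinForm k M := B + l • (LinearMap.mul k k).compl₁₂ (B v) (B v)
  have hB' (x y : M) : B' x y = B x y + l * (B v x * B v y) := rfl
  have hs' : B'.IsSymm := ⟨fun x y => by
    rw [hB', hB', mul_comm (B v x)]; exact congrArg (· + _) (hs.eq x y)⟩
  have hvX' (x : M) : B v ((X : k[X]) • x) = ε * B v x := by
    have h1 := hX v x
    rw [hvX, LinearMap.BilinForm.smul_left] at h1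
    linear_combination (-B v ((X : k[X]) • x)) * hε + ε * h1
  have hX' (x y : M) : B' ((X : k[X]) • x) ((X : k[X]) • y) = B' x y := by
    rw [hB', hB', hX, hvX', hvX']
    linear_combination (l * B v x * B v y) * hε
  have hvv : B' v v = B v v * (d * δ) := by
    rw [hB']
    simp only [l]
    field_simp
    ring
  have hd : (LinearMap.BilinForm.toMatrix c B').det = d * (δ * δ) := by
    have := det_mul_eq_of_submatrix_eq (A := LinearMap.BilinForm.toMatrix c B)
      (A' := LinearMap.BilinForm.toMatrix c B')
      (fun j => by rw [LinearMap.BilinForm.toMatrix_apply, hc0, horth])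
      (fun j => by rw [LinearMap.BilinForm.toMatrix_apply, hc0, hB', horth]; ring)
      (by
        ext i j
        simp only [Matrix.submatrix_apply, LinearMap.BilinForm.toMatrix_apply, hB', horth]
        ring)
    rw [LinearMap.BilinForm.toMatrix_apply, LinearMap.BilinForm.toMatrix_apply, hc0, hvv] at this
    exact mul_right_cancel₀ hv (by linear_combination this)
  have hn' : B'.Nondegenerate := by
    rw [LinearMap.BilinForm.nondegenerate_iff_det_ne_zero c, hd]
    exact mul_ne_zero d.ne_zero (mul_ne_zero hdet hdet)
  refine ⟨B', hn', hs', hX', ?_⟩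
  rw [detClass_eq B' hn' c]
  change _ = squareClass d
  rw [eq_comm, squareClass_eq_iff]
  exact ⟨Units.mk0 δ hdet, hd⟩

theorem hasIsometryWithModule_of_isometry {V : Type*} [AddCommGroup V] [Module k V]
    [Module.Finite k V] {q : LinearMap.BilinForm k V} {B : LinearMap.BilinForm k M}
    (hn : B.Nondegenerate) (hX : ∀ x y : M, B ((X : k[X]) • x) ((X : k[X]) • y) = B x y)
    (e : V ≃ₗ[k] M) (he : ∀ x y, B (e x) (e y) = q x y) : HasIsometryWithModule q M := by
  let φ : M →ₗ[k] M := Algebra.lsmul k k M (X : k[X])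
  have hφ : Function.Injective φ := by
    rw [injective_iff_map_eq_zero]
    intro x hx
    refine hn.1 x fun y => ?_
    rw [← hX]
    change B (φ x) _ = 0
    rw [hx, map_zero, LinearMap.zero_apply]
  let s : M ≃ₗ[k] M := LinearEquiv.ofInjectiveEndo φ hφ
  have hsx (x : M) : s x = (X : k[X]) • x := rfl
  have het (x : V) : e ((e.trans (s.trans e.symm)) x) = (X : k[X]) • e x := by
    simp [hsx]
  refine ⟨e.trans (s.trans e.symm), fun x y => ?_, ⟨LinearEquiv.ofAEval _ e het⟩⟩
  rw [← he, het, het, hX, he]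

theorem HasIsometryWithModule.classMulIsSquare (h2 : (2 : k) ≠ 0) {V : Type*} [AddCommGroup V]
    [Module k V] [Module.Finite k V] {q : LinearMap.BilinForm k V} (hs : q.IsSymm)
    (hq : q.Nondegenerate) (h : HasIsometryWithModule q M) :
    ClassMulIsSquare (detClass q hq) ((charPoly k M).eval 1 * (charPoly k M).eval (-1)) := by
  obtain ⟨t, ht, ⟨e⟩⟩ := h
  have hchar : charPoly k M = (t : V →ₗ[k] V).charpoly := by
    let e' : V ≃ₗ[k] M := (Module.AEval'.of (t : V →ₗ[k] V)).trans (e.restrictScalars k)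
    rw [charPoly, ← LinearEquiv.charpoly_conj e' (t : V →ₗ[k] V)]
    congr 1
    ext x
    obtain ⟨y, rfl⟩ := e'.surjective x
    change (X : k[X]) • e (Module.AEval'.of _ y) = _
    rw [← e.map_smul, Module.AEval'.X_smul_of, LinearEquiv.conj_apply_apply,
      LinearEquiv.symm_apply_apply]
    rfl
  rw [hchar]
  exact isSquare_det_mul_charpoly h2 q hs hq _ ht

theorem classMulIsSquare_iff_eq (c : kˣ ⧸ Subgroup.square kˣ) {a : k} (ha : a ≠ 0) :
    ClassMulIsSquare c a ↔ c = squareClass (Units.mk0 a ha) := by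
  obtain ⟨d, rfl⟩ := QuotientGroup.mk_surjective c
  change ClassMulIsSquare (squareClass d) a ↔ squareClass d = _
  rw [classMulIsSquare_squareClass, squareClass_eq_iff]
  constructor
  · rintro ⟨r, hr⟩
    have hr0 : r ≠ 0 := by
      rintro rfl
      rw [mul_zero] at hr
      exact mul_ne_zero d.ne_zero ha hr
    refine ⟨Units.mk0 r hr0 * d⁻¹, ?_⟩
    have := d.ne_zero
    simp only [Units.val_mk0, Units.val_mul, Units.val_inv_eq_inv_val]
    field_simp
    linear_combination hr
  · rintro ⟨r, hr⟩
    rw [Units.val_mk0] at hr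
    exact ⟨d * r, by rw [hr]; ring⟩

theorem hasIsometryWithModule_of_classMulIsSquare (h2 : (2 : k) ≠ 0) (hk : BinaryUniversal k)
    {V : Type*} [AddCommGroup V] [Module k V] [Module.Finite k V] {q : LinearMap.BilinForm k V}
    (hs : q.IsSymm) (hq : q.Nondegenerate) (hM : HasInvariantForm k M)
    (hss : IsSemisimpleModule k[X] M) (hdim : Module.finrank k V = Module.finrank k M)
    (h : ClassMulIsSquare (detClass q hq)
      ((charPoly k M).eval 1 * (charPoly k M).eval (-1))) :
    HasIsometryWithModule q M := by
  obtain ⟨B, hB, hBs, hX, hdet⟩ : ∃ (B : LinearMap.BilinForm k M) (hB : B.Nondegenerate),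
      B.IsSymm ∧ (∀ x y : M, B ((X : k[X]) • x) ((X : k[X]) • y) = B x y) ∧
        detClass B hB = detClass q hq := by
    by_cases hF : (charPoly k M).eval 1 * (charPoly k M).eval (-1) = 0
    · rcases mul_eq_zero.mp hF with h1 | h1
      · exact hM.exists_detClass_eq h2 hss (by ring) h1 _
      · exact hM.exists_detClass_eq h2 hss (by ring) h1 _
    · obtain ⟨B, hBs, hB, hX⟩ := hM
      refine ⟨B, hB, hBs, hX, ?_⟩
      rw [(classMulIsSquare_iff_eq _ hF).mp h]
      -- With neither `1` nor `-1` an eigenvalue, necessity applied to `B` itself forces its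
      -- determinant to be the class prescribed for `q`.
      exact (classMulIsSquare_iff_eq _ hF).mp (isSquare_det_mul_charpoly h2 B hBs hB _ hX)
  obtain ⟨e, he⟩ := hk.exists_isometry h2 q B hs hBs hq hB hdim hdet.symm
  exact hasIsometryWithModule_of_isometry hB hX e he

end Realization

end QuadIsometry

theorem corollary6p3 {k : Type*} [Field k] (hchar : ringChar k ≠ 2)
    (hcd : QuadIsometry.CohomDimTwoLeOne k)
    {V : Type*} [AddCommGroup V] [Module k V] [Module.Finite k V]
    (q : LinearMap.BilinForm k V) (hsymm : q.IsSymm) (hq : q.Nondegenerate)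
    {M : Type*} [AddCommGroup M] [Module k M] [Module k[X] M] [IsScalarTower k k[X] M]
    [Module.Finite k M]
    (hdual : QuadIsometry.IsSelfDual (k := k) M) (hss : IsSemisimpleModule k[X] M)
    (hdim : Module.finrank k V = Module.finrank k M) :
    (QuadIsometry.HasIsometryWithModule q M ↔
      QuadIsometry.ClassMulIsSquare (QuadIsometry.detClass q hq)
        ((QuadIsometry.charPoly k M).eval 1 * (QuadIsometry.charPoly k M).eval (-1))) ∧
    (∀ hF : (QuadIsometry.charPoly k M).eval 1 * (QuadIsometry.charPoly k M).eval (-1) ≠ 0,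
      (QuadIsometry.HasIsometryWithModule q M ↔
        QuadIsometry.detClass q hq = QuadIsometry.squareClass (Units.mk0 _ hF))) := by
  have h2 : (2 : k) ≠ 0 := Ring.two_ne_zero hchar
  have hk := hcd.binaryUniversal h2
  have main : QuadIsometry.HasIsometryWithModule q M ↔
      QuadIsometry.ClassMulIsSquare (QuadIsometry.detClass q hq)
        ((QuadIsometry.charPoly k M).eval 1 * (QuadIsometry.charPoly k M).eval (-1)) :=
    ⟨fun h => h.classMulIsSquare h2 hsymm hq,
      QuadIsometry.hasIsometryWithModule_of_classMulIsSquare h2 hk hsymm hq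
        (hdual.hasInvariantForm h2 hss) hss hdim⟩
  exact ⟨main, fun hF => main.trans (QuadIsometry.classMulIsSquare_iff_eq _ hF)⟩
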